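/- All logarithms are to base $2$, $\mu$ is Lebesgue measure on $\mathbb{R}^n$, $B^n$ is the closed Euclidean unit ball, and entropies are in bits. Setting. Let $\mathbf{G}\in\mathbb{R}^{n\times n}$ be full-rank, and let $\mathcal{P}\subseteq\mathbb{R}^n$ be a (measurable) basic cell of the lattice $\mathbf{G}\mathbb{Z}^n$, i.e. a bounded set such that $(\mathcal{P}+\mathbf{G}\mathbf{j})_{\mathbf{j}\in\mathbb{Z}^n}$ is a partition of $\mathbb{R}^n$. Let $Q_{\mathcal{P}}(\mathbf{x})$ be the unique $\mathbf{y}\in\mathbf{G}\mathbb{Z}^n$ with $\mathbf{x}\in-\mathcal{P}+\mathbf{y}$. Let $\mathcal{A}\subseteq\mathcal{P}$ be measurable with $\mu(\mathcal{A})>0$. The rejection-sampled universal quantizer (RSUQ) for $\mathcal{A}$ against $\mathcal{P}$ has random state $S=(\mathbf{V}_i)_{i\ge 1}$ with $\mathbf{V}_1,\mathbf{V}_2,\ldots$ i.i.d. $\mathrm{Unif}(\mathcal{P})$, and quantization function $$Q(\mathbf{x},(\mathbf{v}_i)_i)=Q_{\mathcal{P}}(\mathbf{x}-\mathbf{v}_k)+\mathbf{v}_k,\qquad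 k=\min\{i:\,Q_{\mathcal{P}}(\mathbf{x}-\mathbf{v}_i)+\mathbf{v}_i-\mathbf{x}\in\mathcal{A}\}.$$ Its normalized entropy is $$\overline{H}(Q)=\limsup_{\tau\to\infty}\big(H(Q(\mathbf{X}_\tau,S)\,|\,S)-\log\mu(\tau B^n)\big),$$ where $\mathbf{X}_\tau\sim\mathrm{Unif}(\tau B^n)$ is independent of $S$. Theorem. Let $\mathbf{X}\in\mathbb{R}^n$ be a random vector, independent of $S$, with a probability density function $f_{\mathbf{X}}$ that vanishes outside a measurable set $\mathcal{X}\subseteq\mathbb{R}^n$, and suppose that the differential entropy $h(\mathbf{X})=\int f_{\mathbf{X}}\log(1/f_{\mathbf{X}})\,\mathrm{d}\mathbf{x}$ exists in $[-\infty,\infty]$. Let $\epsilon=\mathrm{diam}(\mathcal{A})$, and let $$\delta_\epsilon(\mathbf{x})=\sup_{\mathbf{x}'\in\mathcal{X}:\,\|\mathbf{x}-\mathbf{x}'\|\le\epsilon}\log\frac{f_{\mathbf{X}}(\mathbf{x})}{f_{\mathbf{X}}(\mathbf{x}')},$$ $$\overline{\delta}_\epsilon=\int_{\mathcal{X}}\delta_\epsilon(\mathbf{x})f_{\mathbf{X}}(\mathbf{x})\,\mathrm{d}\mathbf{x}+(\log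 e)\Big(\sup_{\mathbf{x}\in\mathcal{X}}f_{\mathbf{X}}(\mathbf{x})\Big)\,\mu\big((\mathcal{X}+\epsilon B^n)\setminus\mathcal{X}\big)\;\in[0,\infty],$$ where $\log(a/0)=\infty$ for $a>0$, the integrand is $0$ where $f_{\mathbf{X}}=0$, and $0\cdot\infty=0$ (in particular, the last term is $0$ if $\mathcal{X}=\mathbb{R}^n$). Then $$\overline{H}(Q)+h(\mathbf{X})\;\le\;H(Q(\mathbf{X},S)\,|\,S)\;\le\;\overline{H}(Q)+h(\mathbf{X})+\overline{\delta}_\epsilon$$ and $$H(Q(\mathbf{X},S)\,|\,S)\;\le\;h(\mathbf{X})-\log\mu(\mathcal{A})+\log e+\overline{\delta}_\epsilon,$$ where the two upper bounds are regarded as void if $\overline{\delta}_\epsilon=\infty$. -/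

import Mathlib

open MeasureTheory ProbabilityTheory Filter Topology
open scoped ENNReal Pointwise Matrix

noncomputable section

namespace RSUQ

/-- `ℝⁿ` with the Euclidean norm and Lebesgue measure. -/
abbrev E (n : ℕ) : Type := EuclideanSpace ℝ (Fin n)

/-! ### Entropy (in bits) -/

/-- Base-2 logarithm of an extended nonnegative number, with `log 0 = -∞` and `log ∞ = ∞`. -/
def log2 (x : ℝ≥0∞) : EReal := ENNReal.log x / ((Real.log 2 : ℝ) : EReal)

/-- Shannon entropy (in bits) of a discrete law, i.e. of a probability measure carried by
a countable set: the sum of `-p log p` over the point masses `p`. -/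
def entropy {α : Type*} [MeasurableSpace α] (ν : Measure α) : ℝ≥0∞ :=
  ∑' y : α, ENNReal.ofReal (-(ν.real {y} * Real.logb 2 (ν.real {y})))

/-- Conditional entropy `H(Y | S)` (in bits), for `Y` discrete given `S`: the average over `S`
of the entropy of the regular conditional law of `Y` given `S = s`. -/
def condEntropy {Ω α β : Type*} [MeasurableSpace Ω] [MeasurableSpace α] [StandardBorelSpace α]
    [Nonempty α] [MeasurableSpace β] (Y : Ω → α) (S : Ω → β) (μ : Measure Ω)
    [IsFiniteMeasure μ] : ℝ≥0∞ :=
  ∫⁻ s, entropy (condDistrib Y S μ s) ∂(μ.map S)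

/-- `∫ (f log (1/f))⁺`, the positive part of the differential entropy integral. -/
def diffEntropyPos {n : ℕ} (f : E n → ℝ) : ℝ≥0∞ :=
  ∫⁻ x, ENNReal.ofReal (-(f x * Real.logb 2 (f x)))

/-- `∫ (f log (1/f))⁻`, the negative part of the differential entropy integral. -/
def diffEntropyNeg {n : ℕ} (f : E n → ℝ) : ℝ≥0∞ :=
  ∫⁻ x, ENNReal.ofReal (f x * Real.logb 2 (f x))

/-- The integral `∫ f log (1/f)` exists in `[-∞, ∞]`: it is not of the form `∞ - ∞`. -/
def DiffEntropyExists {n : ℕ} (f : E n → ℝ) : Prop :=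
  diffEntropyPos f ≠ ⊤ ∨ diffEntropyNeg f ≠ ⊤

/-- Differential entropy (in bits) `∫ f log (1/f)` of a density `f`, in `[-∞, ∞]`
(meaningful when `DiffEntropyExists f`). -/
def diffEntropy {n : ℕ} (f : E n → ℝ) : EReal :=
  (diffEntropyPos f : EReal) - (diffEntropyNeg f : EReal)

/-! ### Randomized quantizers -/

/-- A randomized quantizer `(P_S, Q)` on `ℝⁿ`. -/
structure RandomizedQuantizer (n : ℕ) where
  /-- the state space -/
  State : Type
  [mState : MeasurableSpace State]
  /-- the state distribution `P_S` -/
  law : Measure State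
  [prob : IsProbabilityMeasure law]
  /-- the quantization function -/
  toFun : E n → State → E n
  measurable_toFun : Measurable (Function.uncurry toFun)
  countable_range : ∀ s, (Set.range fun x => toFun x s).Countable

attribute [instance] RandomizedQuantizer.mState RandomizedQuantizer.prob

/-- The normalized entropy: `limsup` as `τ → ∞` of `H(Q(X_τ, S) | S) - log μ(τ Bⁿ)`, where
`X_τ ∼ Unif(τ Bⁿ)` is independent of `S ∼ P_S`. -/
def RandomizedQuantizer.normalizedEntropy {n : ℕ} (Q : RandomizedQuantizer n) : EReal :=
  limsup (fun τ : ℝ =>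
    (condEntropy (fun p : E n × Q.State => Q.toFun p.1 p.2) (fun p => p.2)
      ((ProbabilityTheory.cond (volume : Measure (E n)) (Metric.closedBall 0 τ)).prod Q.law)
        : EReal)
      - log2 (volume (Metric.closedBall (0 : E n) τ))) atTop

/-! ### Lattices and basic cells -/

/-- The lattice point `G j`. -/
def latticePoint {n : ℕ} (G : Matrix (Fin n) (Fin n) ℝ) (j : Fin n → ℤ) : E n :=
  WithLp.toLp 2 (G *ᵥ fun i => (j i : ℝ))

/-- `P` is a (Borel) basic cell of the lattice `G ℤⁿ`: it is bounded and its translates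
`P + G j`, `j ∈ ℤⁿ`, partition `ℝⁿ`. -/
structure IsBasicCell {n : ℕ} (G : Matrix (Fin n) (Fin n) ℝ) (P : Set (E n)) : Prop where
  measurableSet : MeasurableSet P
  bounded : Bornology.IsBounded P
  partition : ∀ x : E n, ∃! j : Fin n → ℤ, x - latticePoint G j ∈ P

variable {n : ℕ} {G : Matrix (Fin n) (Fin n) ℝ} {P A : Set (E n)}

theorem latticePoint_neg (j : Fin n → ℤ) : latticePoint G (-j) = -latticePoint G j := by
  ext i
  simp [latticePoint, Matrix.mulVec, dotProduct]

theorem IsBasicCell.exists_index (hP : IsBasicCell G P) (x : E n) :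
    ∃ j : Fin n → ℤ, latticePoint G j - x ∈ P := by
  obtain ⟨j, hj, -⟩ := hP.partition (-x)
  refine ⟨-j, ?_⟩
  rw [latticePoint_neg]
  convert hj using 1
  abel

theorem IsBasicCell.index_unique (hP : IsBasicCell G P) {x : E n} {i j : Fin n → ℤ}
    (hi : latticePoint G i - x ∈ P) (hj : latticePoint G j - x ∈ P) : i = j := by
  have h := (hP.partition (-x)).unique (y₁ := -i) (y₂ := -j)
    (by
      rw [latticePoint_neg]
      convert hi using 1
      abel)
    (by
      rw [latticePoint_neg]
      convert hj using 1
      abel)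
  exact neg_injective h

/-- The index `j` of the unique lattice point `y = G j` such that `x ∈ -P + y`. -/
def latticeIndex (hP : IsBasicCell G P) (x : E n) : Fin n → ℤ :=
  Classical.choose (hP.exists_index x)

/-- The lattice quantizer `Q_P`: `Q_P(x)` is the unique lattice point `y` with `x ∈ -P + y`. -/
def latticeQuantizer (hP : IsBasicCell G P) (x : E n) : E n :=
  latticePoint G (latticeIndex hP x)

theorem latticeIndex_eq_iff (hP : IsBasicCell G P) (x : E n) (j : Fin n → ℤ) :
    latticeIndex hP x = j ↔ latticePoint G j - x ∈ P := by
  have h : latticePoint G (latticeIndex hP x) - x ∈ P := Classical.choose_spec (hP.exists_index x)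
  constructor
  · rintro rfl
    exact h
  · intro h'
    exact hP.index_unique h h'

theorem measurable_latticeQuantizer (hP : IsBasicCell G P) :
    Measurable (latticeQuantizer hP) := by
  have h1 : Measurable (latticeIndex hP) := by
    refine measurable_to_countable' fun j => ?_
    have : latticeIndex hP ⁻¹' {j} = (fun x => latticePoint G j - x) ⁻¹' P := by
      ext x
      exact latticeIndex_eq_iff hP x j
    rw [this]
    exact (measurable_const.sub measurable_id) hP.measurableSet
  exact (Measurable.of_discrete (f := latticePoint G)).comp h1

theorem IsBasicCell.volume_ne_zero (hP : IsBasicCell G P) : volume P ≠ 0 := by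
  intro h0
  have hcov : (Set.univ : Set (E n)) ⊆ ⋃ j : Fin n → ℤ, (fun x => x - latticePoint G j) ⁻¹' P := by
    intro x _
    obtain ⟨j, hj, -⟩ := hP.partition x
    exact Set.mem_iUnion.2 ⟨j, hj⟩
  have hz : volume (⋃ j : Fin n → ℤ, (fun x => x - latticePoint G j) ⁻¹' P) = 0 := by
    refine measure_iUnion_null fun j => ?_
    simpa only [sub_eq_add_neg, measure_preimage_add_right] using h0
  have := measure_mono_null hcov hz
  exact (NeZero.ne (volume : Measure (E n))) (Measure.measure_univ_eq_zero.1 this)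

theorem IsBasicCell.isProbabilityMeasure (hP : IsBasicCell G P) :
    IsProbabilityMeasure (ProbabilityTheory.cond (volume : Measure (E n)) P) :=
  cond_isProbabilityMeasure_of_finite hP.volume_ne_zero hP.bounded.measure_lt_top.ne

/-! ### The rejection-sampled universal quantizer -/

/-- The index `k = min {i : Q_P(x - v_i) + v_i - x ∈ A}` of the first accepted dither
(with value `0` in the case, of probability zero when `A` has positive measure, that no dither is
accepted). Dithers are indexed by `0, 1, 2, …`. -/
def acceptIndex (hP : IsBasicCell G P) (A : Set (E n)) (x : E n) (v : ℕ → E n) : ℕ :=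
  sInf {i : ℕ | latticeQuantizer hP (x - v i) + v i - x ∈ A}

/-- The quantization function `Q_{A,P}(x, v) = Q_P(x - v_k) + v_k`. -/
def rsuqFun (hP : IsBasicCell G P) (A : Set (E n)) (x : E n) (v : ℕ → E n) : E n :=
  latticeQuantizer hP (x - v (acceptIndex hP A x v)) + v (acceptIndex hP A x v)

theorem measurable_acceptIndex (hP : IsBasicCell G P) (hA : MeasurableSet A) :
    Measurable fun p : E n × (ℕ → E n) => acceptIndex hP A p.1 p.2 := by
  have hm : ∀ i : ℕ, MeasurableSet
      {p : E n × (ℕ → E n) | latticeQuantizer hP (p.1 - p.2 i) + p.2 i - p.1 ∈ A} := by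
    intro i
    have h2 : Measurable fun p : E n × (ℕ → E n) => p.2 i :=
      (measurable_pi_apply i).comp measurable_snd
    exact ((((measurable_latticeQuantizer hP).comp (measurable_fst.sub h2)).add h2).sub
      measurable_fst) hA
  refine measurable_of_Iic fun m => ?_
  have hset : (fun p : E n × (ℕ → E n) => acceptIndex hP A p.1 p.2) ⁻¹' Set.Iic m =
      (⋃ i ∈ Set.Iic m,
        {p : E n × (ℕ → E n) | latticeQuantizer hP (p.1 - p.2 i) + p.2 i - p.1 ∈ A}) ∪
      ⋂ i, {p : E n × (ℕ → E n) | latticeQuantizer hP (p.1 - p.2 i) + p.2 i - p.1 ∈ A}ᶜ := by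
    ext p
    simp only [Set.mem_preimage, Set.mem_Iic, Set.mem_union, Set.mem_iUnion, Set.mem_ofPred_eq,
      Set.mem_iInter, Set.mem_compl_iff, acceptIndex]
    constructor
    · intro h
      by_cases hne : {i : ℕ | latticeQuantizer hP (p.1 - p.2 i) + p.2 i - p.1 ∈ A}.Nonempty
      · exact Or.inl ⟨_, h, Nat.sInf_mem hne⟩
      · right
        intro i hi
        exact hne ⟨i, hi⟩
    · rintro (⟨i, hi, h⟩ | h)
      · exact (Nat.sInf_le h).trans hi
      · have : {i : ℕ | latticeQuantizer hP (p.1 - p.2 i) + p.2 i - p.1 ∈ A} = ∅ :=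
          Set.eq_empty_of_forall_notMem h
        simp [this]
  rw [hset]
  exact (MeasurableSet.biUnion (Set.to_countable _) fun i _ => hm i).union
    (MeasurableSet.iInter fun i => (hm i).compl)

theorem measurable_rsuqFun (hP : IsBasicCell G P) (hA : MeasurableSet A) :
    Measurable (Function.uncurry (rsuqFun hP A)) := by
  have hg : Measurable fun q : ℕ × (E n × (ℕ → E n)) => q.2.2 q.1 := by
    refine measurable_from_prod_countable_right fun i => ?_
    exact (measurable_pi_apply i).comp measurable_snd
  have hv : Measurable fun p : E n × (ℕ → E n) => p.2 (acceptIndex hP A p.1 p.2) :=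
    hg.comp ((measurable_acceptIndex hP hA).prodMk measurable_id)
  exact ((measurable_latticeQuantizer hP).comp (measurable_fst.sub hv)).add hv

theorem countable_range_rsuqFun (hP : IsBasicCell G P) (A : Set (E n)) (v : ℕ → E n) :
    (Set.range fun x => rsuqFun hP A x v).Countable := by
  refine (Set.countable_range
    fun q : (Fin n → ℤ) × ℕ => latticePoint G q.1 + v q.2).mono ?_
  rintro _ ⟨x, rfl⟩
  exact ⟨(latticeIndex hP (x - v (acceptIndex hP A x v)), acceptIndex hP A x v), rfl⟩

/-- The RSUQ for `A` against the basic cell `P`: the state is an i.i.d. sequence of dithers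
`V_i ∼ Unif(P)`, and the quantization function is `Q_{A,P}`. -/
def rsuq (hP : IsBasicCell G P) (hA : MeasurableSet A) : RandomizedQuantizer n :=
  haveI : IsProbabilityMeasure (ProbabilityTheory.cond (volume : Measure (E n)) P) :=
    hP.isProbabilityMeasure
  { State := ℕ → E n
    law := Measure.infinitePi fun _ : ℕ => ProbabilityTheory.cond (volume : Measure (E n)) P
    toFun := rsuqFun hP A
    measurable_toFun := measurable_rsuqFun hP hA
    countable_range := countable_range_rsuqFun hP A }

/-! ### The smoothness term -/

/-- `δ_ε(x) = sup {log (f(x) / f(x')) : x' ∈ 𝒳, ‖x - x'‖ ≤ ε}`, where `log (a / 0) = ∞` if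
`a > 0`. -/
def deltaLocal (f : E n → ℝ) (𝒳 : Set (E n)) (ε : ℝ) (x : E n) : EReal :=
  ⨆ x' ∈ {x' : E n | x' ∈ 𝒳 ∧ ‖x - x'‖ ≤ ε},
    log2 (ENNReal.ofReal (f x) / ENNReal.ofReal (f x'))

/-- `∫_𝒳 δ_ε(x) f(x) dx + (log e) (sup_𝒳 f) μ((𝒳 + ε Bⁿ) \ 𝒳)`, in `[0, ∞]`, where `0 · ∞ = 0`.
(At every `x ∈ 𝒳` with `f(x) > 0` one has `δ_ε(x) ≥ 0`, so that `EReal.toENNReal` does not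
truncate anything there.) -/
def deltaBar (f : E n → ℝ) (𝒳 : Set (E n)) (ε : ℝ) : ℝ≥0∞ :=
  (∫⁻ x in 𝒳, (deltaLocal f 𝒳 ε x).toENNReal * ENNReal.ofReal (f x)) +
    ENNReal.ofReal (Real.logb 2 (Real.exp 1)) * (⨆ x ∈ 𝒳, ENNReal.ofReal (f x)) *
      volume ((𝒳 + Metric.closedBall (0 : E n) ε) \ 𝒳)

end RSUQ

end

noncomputable section

namespace RSUQ

section

/-! Let `C` be the cell of `X` at state `S`, `N` its mass under the law `ν` of `X`, `M` its volume,
`M'` the volume of `C ∩ 𝒳`, and `a = μ(A)`. The conditional entropy is the mean of `-log N`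
(`condEntropy_eq`), and it is compared with the mean of `-log (f(X) M)`. The difference is
nonnegative by Gibbs' inequality, because `N / (M f(X))` has mean at most 1
(`lintegral_mass_div_volume_le`). It is at most `deltaBar`: in `log (f M / N) = log (f M' / N) + log
(M / M')` the first term is bounded by `δ_ε(X)`, since `C` has diameter at most `ε`, and the second
is charged to the part of `C` lying in `(𝒳 + ε Bⁿ) \ 𝒳`.

The mean of `log (a / M)` over the state is a constant `ℓ` independent of `x`, because translating
the input amounts to translating the dithers modulo the lattice, which preserves their law
(`lintegral_ditherLaw_stationary`). So `H(Q | S)` lies between `h(X) + ℓ - log a` and that plus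
`deltaBar`. For the uniform law on a large ball `deltaBar` tends to 0, which identifies the
normalized entropy as `ℓ - log a` (`StationaryCells.normalizedEntropy_eq`) and gives the first two
bounds.

The third needs `ℓ ≤ log e` (`lintegral_logb_cellVolume_le`). With `K` the number of rejections and
`p` the acceptance probability, `log (a / M) = log ((1-p)^K a / M) + K log (1 / (1-p))`. Apply `log
u ≤ (u - 1) log e` to both terms. The mean of `(1-p)^K a / M` is at most 1, since `1 / M` on `K = i`
has mean at most `1 / μ(P)` (`lintegral_inv_cellVolume_le`), and `K` has mean at most `(1-p) / p`.

Signed integrals are avoided: estimates are stated in `ℝ≥0∞` with positive and negative parts on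
opposite sides, and only rearranged at the end. -/

theorem _root_.Measurable.real_logb {α : Type*} [MeasurableSpace α] {g : α → ℝ}
    (hg : Measurable g) : Measurable fun x => Real.logb 2 (g x) :=
  hg.log.div_const _

/-! ### Countably valued maps -/

/-- There are only countably many fibres, so the union of the null ones is null. -/
theorem ae_fiber_ne_zero {α β : Type*} [MeasurableSpace α] {q : α → β}
    (hc : (Set.range q).Countable) (ρ : Measure α) :
    ∀ᵐ x ∂ρ, ρ (q ⁻¹' {q x}) ≠ 0 := by
  have : Countable (Set.range q) := hc.to_subtype
  have h0 : ρ (⋃ y : {y : Set.range q // ρ (q ⁻¹' {y.1}) = 0}, q ⁻¹' {y.1.1}) = 0 :=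
    measure_iUnion_null fun y => y.2
  refine measure_mono_null (fun x hx => ?_) h0
  have hx : ρ (q ⁻¹' {q x}) = 0 := by simpa using hx
  exact Set.mem_iUnion.2 ⟨⟨⟨q x, x, rfl⟩, hx⟩, rfl⟩

section CountablyValued

variable {α β : Type*} [MeasurableSpace α] [MeasurableSpace β] [MeasurableSingletonClass β]
  {q : α → β}

theorem lintegral_eq_tsum_fiber (hq : Measurable q) (hc : (Set.range q).Countable)
    (ρ : Measure α) (g : α → ℝ≥0∞) :
    ∫⁻ x, g x ∂ρ = ∑' y : Set.range q, ∫⁻ x in q ⁻¹' {y.1}, g x ∂ρ := by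
  have : Countable (Set.range q) := hc.to_subtype
  rw [← lintegral_iUnion (fun y => hq (measurableSet_singleton _))]
  · have : (⋃ y : Set.range q, q ⁻¹' {y.1}) = Set.univ := by
      ext x
      simp
    rw [this, Measure.restrict_univ]
  · intro y z hyz
    refine Set.disjoint_left.2 fun x hx hx' => hyz (Subtype.ext ?_)
    exact (Set.mem_singleton_iff.1 hx).symm.trans hx'

theorem setLIntegral_fiber (hq : Measurable q) (ρ : Measure α) (g : β → ℝ≥0∞) (y : β) :
    ∫⁻ x in q ⁻¹' {y}, g (q x) ∂ρ = g y * ρ (q ⁻¹' {y}) := by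
  rw [setLIntegral_congr_fun (g := fun _ => g y) (hq (measurableSet_singleton y))]
  · simp
  · intro x hx
    simp only
    rw [Set.mem_singleton_iff.1 hx]

theorem lintegral_comp_eq_tsum (hq : Measurable q) (hc : (Set.range q).Countable)
    (ρ : Measure α) (g : β → ℝ≥0∞) :
    ∫⁻ x, g (q x) ∂ρ = ∑' y : Set.range q, g y.1 * ρ (q ⁻¹' {y.1}) := by
  rw [lintegral_eq_tsum_fiber hq hc]
  exact tsum_congr fun y => setLIntegral_fiber hq ρ g y.1

theorem tsum_fiber_eq (hq : Measurable q) (hc : (Set.range q).Countable) (ρ : Measure α) :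
    ∑' y : Set.range q, ρ (q ⁻¹' {y.1}) = ρ Set.univ := by
  have := lintegral_comp_eq_tsum hq hc ρ 1
  simpa using this.symm

/-- The entropy of a countably valued function, as the mean information content. -/
theorem entropy_map_eq (hq : Measurable q) (hc : (Set.range q).Countable)
    (ν : Measure α) [IsProbabilityMeasure ν] :
    entropy (ν.map q) =
      ∫⁻ x, ENNReal.ofReal (-Real.logb 2 (ν (q ⁻¹' {q x})).toReal) ∂ν := by
  rw [lintegral_comp_eq_tsum hq hc ν fun y => ENNReal.ofReal (-Real.logb 2 (ν (q ⁻¹' {y})).toReal)]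
  rw [entropy, ← tsum_subtype_eq_of_support_subset (s := Set.range q)]
  · refine tsum_congr fun y => ?_
    rw [Measure.real, Measure.map_apply hq (measurableSet_singleton _), ← mul_neg, mul_comm,
      ENNReal.ofReal_mul' ENNReal.toReal_nonneg, ENNReal.ofReal_toReal (measure_ne_top _ _)]
  · intro y hy
    by_contra hy'
    apply hy
    have : q ⁻¹' {y} = ∅ := by
      ext x
      simp only [Set.mem_preimage, Set.mem_singleton_iff, Set.mem_empty_iff_false, iff_false]
      exact fun h => hy' ⟨x, h⟩
    simp [Measure.real, Measure.map_apply hq (measurableSet_singleton _), this]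

end CountablyValued

/-! ### Cells of a randomized quantizer -/

/-- The mass `ρ {x' : Q(x', s) = Q(x, s)}` of the quantization cell of `x` at state `s`. -/
def RandomizedQuantizer.cellMass {n : ℕ} (Q : RandomizedQuantizer n) (ρ : Measure (E n))
    (x : E n) (s : Q.State) : ℝ≥0∞ :=
  ρ ((fun x' => Q.toFun x' s) ⁻¹' {Q.toFun x s})

variable {n : ℕ} (Q : RandomizedQuantizer n)

theorem RandomizedQuantizer.measurable_section (s : Q.State) :
    Measurable fun x => Q.toFun x s :=
  Q.measurable_toFun.comp (measurable_id.prodMk measurable_const)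

theorem RandomizedQuantizer.measurable_cellMass (ρ : Measure (E n)) [SFinite ρ] :
    Measurable (Function.uncurry (Q.cellMass ρ)) := by
  have hset : MeasurableSet {p : (E n × Q.State) × E n | Q.toFun p.2 p.1.2 = Q.toFun p.1.1 p.1.2} :=
    measurableSet_eq_fun
      (Q.measurable_toFun.comp (measurable_snd.prodMk (measurable_snd.comp measurable_fst)))
      (Q.measurable_toFun.comp measurable_fst)
  exact measurable_measure_prodMk_left hset

/-- By independence, the law of `Q(X, s)` with `s` frozen is a version of the conditional law given
`S = s`; disintegrations are a.e. unique, so `condDistrib` may be replaced by this explicit kernel.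
-/
theorem condEntropy_eq {Ω : Type*} [MeasurableSpace Ω] {μ : Measure Ω} [IsProbabilityMeasure μ]
    {X : Ω → E n} {S : Ω → Q.State} {ν : Measure (E n)} [IsProbabilityMeasure ν]
    (hX : HasLaw X ν μ) (hS : HasLaw S Q.law μ) (hXS : IndepFun X S μ) :
    condEntropy (fun ω => Q.toFun (X ω) (S ω)) S μ =
      ∫⁻ p, ENNReal.ofReal (-Real.logb 2 (Q.cellMass ν p.1 p.2).toReal) ∂(ν.prod Q.law) := by
  have hm1 : Measurable fun p : Q.State × E n => Q.toFun p.2 p.1 :=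
    Q.measurable_toFun.comp measurable_swap
  have hXS' : HasLaw (fun ω => (S ω, X ω)) (Q.law.prod ν) μ := hXS.symm.hasLaw_prod hS hX
  let κ : Kernel Q.State (E n) := ((Kernel.id).prod (Kernel.const Q.State ν)).map
    fun p : Q.State × E n => Q.toFun p.2 p.1
  have : IsMarkovKernel κ := Kernel.IsMarkovKernel.map _ hm1
  have hκ : ∀ s, κ s = ν.map fun x => Q.toFun x s := by
    intro s
    rw [Kernel.map_apply _ hm1, Kernel.prod_apply, Kernel.id_apply, Kernel.const_apply,
      Measure.dirac_prod, Measure.map_map hm1 (by fun_prop)]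
    rfl
  have hY : AEMeasurable (fun ω => Q.toFun (X ω) (S ω)) μ :=
    Q.measurable_toFun.comp_aemeasurable (hX.aemeasurable.prodMk hS.aemeasurable)
  have hae : condDistrib (fun ω => Q.toFun (X ω) (S ω)) S μ =ᵐ[μ.map S] κ := by
    refine condDistrib_ae_eq_of_measure_eq_compProd S hY ?_
    have hg : Measurable fun p : Q.State × E n => (p.1, Q.toFun p.2 p.1) :=
      measurable_fst.prodMk hm1
    have : (fun ω => (S ω, Q.toFun (X ω) (S ω))) =
        (fun p : Q.State × E n => (p.1, Q.toFun p.2 p.1)) ∘ fun ω => (S ω, X ω) := rfl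
    rw [this, ← AEMeasurable.map_map_of_aemeasurable hg.aemeasurable hXS'.aemeasurable,
      hXS'.map_eq, hS.map_eq]
    ext t ht
    rw [Measure.map_apply hg ht, Measure.compProd_apply ht, Measure.prod_apply (hg ht)]
    refine lintegral_congr fun s => ?_
    rw [hκ, Measure.map_apply (Q.measurable_section s) (measurable_prodMk_left ht)]
    rfl
  have hint : ∀ᵐ s ∂μ.map S, entropy (condDistrib (fun ω => Q.toFun (X ω) (S ω)) S μ s) =
      entropy (κ s) := hae.mono fun s hs => congrArg entropy hs
  rw [condEntropy, lintegral_congr_ae hint, hS.map_eq, lintegral_prod_symm]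
  · refine lintegral_congr fun s => ?_
    rw [hκ, entropy_map_eq (Q.measurable_section s) (Q.countable_range s)]
    rfl
  · refine Measurable.aemeasurable ?_
    exact (Measurable.real_logb (Q.measurable_cellMass ν).ennreal_toReal).neg.ennreal_ofReal

end

section

/-! ### Differential entropy as a mean information content -/

variable {n : ℕ} {f : E n → ℝ}

theorem diffEntropyPos_eq (hf : Measurable f) (hf0 : ∀ x, 0 ≤ f x) :
    diffEntropyPos f =
      ∫⁻ x, ENNReal.ofReal (-Real.logb 2 (f x)) ∂volume.withDensity fun x => ENNReal.ofReal (f x) := by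
  rw [lintegral_withDensity_eq_lintegral_mul _ hf.ennreal_ofReal
    (g := fun x => ENNReal.ofReal (-Real.logb 2 (f x))) hf.real_logb.neg.ennreal_ofReal]
  refine lintegral_congr fun x => ?_
  rw [Pi.mul_apply, ← ENNReal.ofReal_mul (hf0 x), mul_neg]

theorem diffEntropyNeg_eq (hf : Measurable f) (hf0 : ∀ x, 0 ≤ f x) :
    diffEntropyNeg f =
      ∫⁻ x, ENNReal.ofReal (Real.logb 2 (f x)) ∂volume.withDensity fun x => ENNReal.ofReal (f x) := by
  rw [lintegral_withDensity_eq_lintegral_mul _ hf.ennreal_ofReal hf.real_logb.ennreal_ofReal]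
  refine lintegral_congr fun x => ?_
  rw [Pi.mul_apply, ← ENNReal.ofReal_mul (hf0 x)]

theorem ae_pos_withDensity (hf : Measurable f) :
    ∀ᵐ x ∂volume.withDensity fun x => ENNReal.ofReal (f x), 0 < f x := by
  rw [ae_withDensity_iff hf.ennreal_ofReal]
  exact Eventually.of_forall fun x hx => by simpa using hx

/-! ### Pointwise estimates -/

/-- Removes the truncation in `ENNReal.ofReal`, so that inequalities between sums of positive and
negative parts become linear ones over `ℝ`. -/
theorem exists_pos_neg_parts (x : ℝ) : ∃ p m : ℝ, 0 ≤ p ∧ 0 ≤ m ∧ x = p - m ∧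
    ENNReal.ofReal x = ENNReal.ofReal p ∧ ENNReal.ofReal (-x) = ENNReal.ofReal m := by
  rcases le_total 0 x with h | h
  · exact ⟨x, 0, h, le_rfl, by simp, rfl, by simpa using h⟩
  · exact ⟨0, -x, le_rfl, by simpa using h, by simp, by simpa using h, rfl⟩

theorem logb_two_le_mul_sub_one {t : ℝ} (ht : 0 < t) :
    Real.logb 2 t ≤ Real.logb 2 (Real.exp 1) * (t - 1) := by
  rw [Real.logb, Real.logb, Real.log_exp, div_mul_eq_mul_div, one_mul]
  exact div_le_div_of_nonneg_right (Real.log_le_sub_one_of_pos ht) (Real.log_pos one_lt_two).le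

theorem logb_two_exp_one_pos : 0 < Real.logb 2 (Real.exp 1) :=
  Real.logb_pos one_lt_two (by simp)

/-- This is `log u ≤ (u - 1) log e` at `u = N / (M t)`, rearranged so that no term is subtracted. In
use, `t` is the density at `x`, and `N`, `M` are the mass and volume of its cell. -/
theorem information_lower_bound {t N M a : ℝ} (ht : 0 < t) (hN : 0 < N) (hN1 : N ≤ 1) (hM : 0 < M)
    (hMa : M ≤ a) :
    ENNReal.ofReal (-Real.logb 2 t) + ENNReal.ofReal (Real.logb 2 (a / M))
        + ENNReal.ofReal (-Real.logb 2 a) + ENNReal.ofReal (Real.logb 2 (Real.exp 1)) ≤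
      ENNReal.ofReal (Real.logb 2 t) + ENNReal.ofReal (Real.logb 2 a)
        + ENNReal.ofReal (-Real.logb 2 N)
        + ENNReal.ofReal (Real.logb 2 (Real.exp 1)) * ENNReal.ofReal (N / (M * t)) := by
  have ha : 0 < a := hM.trans_le hMa
  have h1 := logb_two_le_mul_sub_one (t := N / (M * t)) (by positivity)
  rw [Real.logb_div hN.ne' (by positivity), Real.logb_mul hM.ne' ht.ne'] at h1
  have h2 : 0 ≤ -Real.logb 2 N := by
    simpa using Real.logb_nonpos one_lt_two hN.le hN1
  have h3 : 0 ≤ Real.logb 2 (a / M) :=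
    Real.logb_nonneg one_lt_two ((one_le_div hM).2 hMa)
  have h4 := Real.logb_div (b := 2) ha.ne' hM.ne'
  obtain ⟨p, m, hp, hm, e1, e2, e3⟩ := exists_pos_neg_parts (Real.logb 2 t)
  obtain ⟨p', m', hp', hm', e1', e2', e3'⟩ := exists_pos_neg_parts (Real.logb 2 a)
  have hl := logb_two_exp_one_pos.le
  have hw : 0 ≤ N / (M * t) := by positivity
  rw [e2, e3, e2', e3', ← ENNReal.ofReal_mul hl, ← ENNReal.ofReal_add hm h3,
    ← ENNReal.ofReal_add (by positivity) hm', ← ENNReal.ofReal_add (by positivity) hl,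
    ← ENNReal.ofReal_add hp hp', ← ENNReal.ofReal_add (by positivity) h2,
    ← ENNReal.ofReal_add (by positivity) (by positivity)]
  exact ENNReal.ofReal_le_ofReal (by linarith)

/-- The logarithms telescope to an identity; the only loss is the negative part of `log (t M' / N)`.
Here `M'` will be the volume of the cell inside `𝒳`. -/
theorem information_upper_bound {t N M M' a : ℝ} (ht : 0 < t) (hN : 0 < N) (hN1 : N ≤ 1)
    (hM' : 0 < M') (hM'M : M' ≤ M) (hMa : M ≤ a) :
    ENNReal.ofReal (-Real.logb 2 N) + ENNReal.ofReal (Real.logb 2 t)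
        + ENNReal.ofReal (Real.logb 2 a) ≤
      ENNReal.ofReal (-Real.logb 2 t) + ENNReal.ofReal (Real.logb 2 (a / M))
        + ENNReal.ofReal (-Real.logb 2 a) + (ENNReal.ofReal (Real.logb 2 (t * M' / N))
        + ENNReal.ofReal (Real.logb 2 (M / M'))) := by
  have hM : 0 < M := hM'.trans_le hM'M
  have ha : 0 < a := hM.trans_le hMa
  have h1 : Real.logb 2 (t * M' / N) = Real.logb 2 t + Real.logb 2 M' - Real.logb 2 N := by
    rw [Real.logb_div (by positivity) hN.ne', Real.logb_mul ht.ne' hM'.ne']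
  have h2 : 0 ≤ -Real.logb 2 N := by
    simpa using Real.logb_nonpos one_lt_two hN.le hN1
  have h3 : 0 ≤ Real.logb 2 (a / M) :=
    Real.logb_nonneg one_lt_two ((one_le_div hM).2 hMa)
  have h5 : 0 ≤ Real.logb 2 (M / M') :=
    Real.logb_nonneg one_lt_two ((one_le_div hM').2 hM'M)
  have h4 := Real.logb_div (b := 2) ha.ne' hM.ne'
  have h6 := Real.logb_div (b := 2) hM.ne' hM'.ne'
  obtain ⟨p, m, hp, hm, e1, e2, e3⟩ := exists_pos_neg_parts (Real.logb 2 t)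
  obtain ⟨p', m', hp', hm', e1', e2', e3'⟩ := exists_pos_neg_parts (Real.logb 2 a)
  obtain ⟨p'', m'', hp'', hm'', e1'', e2'', -⟩ := exists_pos_neg_parts (Real.logb 2 (t * M' / N))
  rw [e2, e3, e2', e3', e2'', ← ENNReal.ofReal_add h2 hp,
    ← ENNReal.ofReal_add (by positivity) hp', ← ENNReal.ofReal_add hm h3,
    ← ENNReal.ofReal_add (by positivity) hm', ← ENNReal.ofReal_add hp'' h5,
    ← ENNReal.ofReal_add (by positivity) (by positivity)]
  exact ENNReal.ofReal_le_ofReal (by linarith)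

/-! ### Extended base-2 logarithms and the local oscillation of the density -/

theorem log2_ofReal {r : ℝ} (hr : 0 < r) :
    log2 (ENNReal.ofReal r) = ((Real.logb 2 r : ℝ) : EReal) := by
  rw [log2, ENNReal.log_ofReal_of_pos hr, ← EReal.coe_div, Real.logb]

theorem log2_eq_logb {x : ℝ≥0∞} (h0 : x ≠ 0) (h1 : x ≠ ⊤) :
    log2 x = ((Real.logb 2 x.toReal : ℝ) : EReal) := by
  rw [← log2_ofReal (ENNReal.toReal_pos h0 h1), ENNReal.ofReal_toReal h1]

theorem log2_top : log2 ⊤ = ⊤ := by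
  rw [log2, ENNReal.log_top, EReal.top_div_of_pos_ne_top]
  · exact_mod_cast Real.log_pos one_lt_two
  · exact EReal.coe_ne_top _

/-- If `δ_ε(x) = d` is finite, then `f x ≤ 2 ^ d * f x'` for all `x' ∈ 𝒳` near `x`. -/
theorem le_rpow_mul_of_deltaLocal_eq (hf0 : ∀ x, 0 ≤ f x) {𝒳 : Set (E n)} {ε : ℝ} {x x' : E n}
    {d : ℝ} (hd : deltaLocal f 𝒳 ε x ≤ (d : EReal)) (hx' : x' ∈ 𝒳) (hxx' : ‖x - x'‖ ≤ ε) :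
    f x ≤ (2 : ℝ) ^ d * f x' := by
  rcases (hf0 x).eq_or_lt with hx0 | hx0
  · rw [← hx0]
    have := hf0 x'
    positivity
  have h1 : log2 (ENNReal.ofReal (f x) / ENNReal.ofReal (f x')) ≤ (d : EReal) :=
    (le_iSup₂ (f := fun x' (_ : x' ∈ {x' : E n | x' ∈ 𝒳 ∧ ‖x - x'‖ ≤ ε}) =>
      log2 (ENNReal.ofReal (f x) / ENNReal.ofReal (f x'))) x' ⟨hx', hxx'⟩).trans hd
  rcases (hf0 x').eq_or_lt with hx0' | hx0'
  · rw [← hx0', ENNReal.ofReal_zero, ENNReal.div_zero (by simpa using hx0), log2_top] at h1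
    exact absurd h1 (by simp)
  · rw [← ENNReal.ofReal_div_of_pos hx0', log2_ofReal (by positivity), EReal.coe_le_coe_iff,
      Real.logb_le_iff_le_rpow one_lt_two (by positivity), div_le_iff₀ hx0'] at h1
    exact h1

end

section

/-! ### Estimates on the cells of a countably valued map -/

variable {n : ℕ} {f : E n → ℝ} {𝒳 : Set (E n)} {ε : ℝ}

/-- On a set `C` of points close to `x`, the mean of `f` over `C ∩ 𝒳` is at least
`f x * 2 ^ (-δ_ε(x))`. -/
theorem ofReal_logb_le_deltaLocal (hf : Measurable f) (hf0 : ∀ x, 0 ≤ f x)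
    (h𝒳 : MeasurableSet 𝒳) {ν : Measure (E n)} [IsProbabilityMeasure ν]
    (hν : ν = volume.withDensity fun x => ENNReal.ofReal (f x)) {C : Set (E n)}
    (hC : MeasurableSet C) {x : E n} (hx : 0 < f x) (hN : ν C ≠ 0)
    (hM0 : volume.restrict 𝒳 C ≠ 0) (hM1 : volume.restrict 𝒳 C ≠ ⊤)
    (hxC : ∀ᵐ x', x' ∈ C → ‖x - x'‖ ≤ ε) :
    ENNReal.ofReal (Real.logb 2 (f x * (volume.restrict 𝒳 C).toReal / (ν C).toReal)) ≤
      (deltaLocal f 𝒳 ε x).toENNReal := by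
  rcases eq_or_ne (deltaLocal f 𝒳 ε x) ⊤ with hD | hD
  · rw [hD]
    simp
  rw [EReal.toENNReal_of_ne_top hD]
  refine ENNReal.ofReal_le_ofReal ?_
  set d := (deltaLocal f 𝒳 ε x).toReal with hd
  have hDd : deltaLocal f 𝒳 ε x ≤ (d : EReal) := EReal.le_coe_toReal hD
  have hNpos := ENNReal.toReal_pos hN (measure_ne_top ν C)
  have hMpos := ENNReal.toReal_pos hM0 hM1
  have h2d : (0 : ℝ) < 2 ^ d := by positivity
  have hle : ENNReal.ofReal (f x) * volume.restrict 𝒳 C ≤ ENNReal.ofReal (2 ^ d) * ν C := by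
    calc ENNReal.ofReal (f x) * volume.restrict 𝒳 C
        = ∫⁻ _ in C ∩ 𝒳, ENNReal.ofReal (f x) := by
          rw [setLIntegral_const, Measure.restrict_apply hC]
      _ ≤ ∫⁻ x' in C ∩ 𝒳, ENNReal.ofReal (2 ^ d) * ENNReal.ofReal (f x') := by
          refine lintegral_mono_ae ?_
          rw [ae_restrict_iff' (hC.inter h𝒳)]
          filter_upwards [hxC] with x' h1 h2
          rw [← ENNReal.ofReal_mul h2d.le]
          exact ENNReal.ofReal_le_ofReal (le_rpow_mul_of_deltaLocal_eq hf0 hDd h2.2 (h1 h2.1))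
      _ ≤ ∫⁻ x' in C, ENNReal.ofReal (2 ^ d) * ENNReal.ofReal (f x') :=
          lintegral_mono_set Set.inter_subset_left
      _ = ENNReal.ofReal (2 ^ d) * ν C := by
          rw [lintegral_const_mul _ hf.ennreal_ofReal, hν, withDensity_apply _ hC]
  have hreal := ENNReal.toReal_mono
    (ENNReal.mul_ne_top ENNReal.ofReal_ne_top (measure_ne_top ν C)) hle
  rw [ENNReal.toReal_mul, ENNReal.toReal_mul, ENNReal.toReal_ofReal hx.le,
    ENNReal.toReal_ofReal h2d.le] at hreal
  rw [Real.logb_le_iff_le_rpow one_lt_two (by positivity), div_le_iff₀ hNpos]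
  exact hreal

variable {β : Type*} [MeasurableSpace β] [MeasurableSingletonClass β] {q : E n → β}

/-- Integrating against `ν` cancels the `f x` in the denominator. What remains is constant on each
cell, and its integral over a cell is at most the mass of that cell. -/
theorem lintegral_mass_div_volume_le (hf : Measurable f) (hf0 : ∀ x, 0 ≤ f x)
    {ν : Measure (E n)} [IsProbabilityMeasure ν]
    (hν : ν = volume.withDensity fun x => ENNReal.ofReal (f x)) (hq : Measurable q)
    (hc : (Set.range q).Countable) :
    ∫⁻ x, ENNReal.ofReal ((ν (q ⁻¹' {q x})).toReal / ((volume (q ⁻¹' {q x})).toReal * f x)) ∂ν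
      ≤ 1 := by
  have hle : ∀ g : E n → ℝ≥0∞, ∫⁻ x, g x ∂ν ≤ ∫⁻ x, ENNReal.ofReal (f x) * g x := fun g => by
    rw [hν]
    exact lintegral_withDensity_le_lintegral_mul _ hf.ennreal_ofReal g
  calc _ ≤ ∫⁻ x, ENNReal.ofReal (f x) * ENNReal.ofReal
        ((ν (q ⁻¹' {q x})).toReal / ((volume (q ⁻¹' {q x})).toReal * f x)) := by
        exact hle _
    _ ≤ ∫⁻ x, ν (q ⁻¹' {q x}) / volume (q ⁻¹' {q x}) := by
        refine lintegral_mono fun x => ?_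
        simp only
        rw [← ENNReal.ofReal_mul (hf0 x)]
        refine le_trans (ENNReal.ofReal_le_ofReal ?_) ENNReal.ofReal_toReal_le
        rw [ENNReal.toReal_div]
        rcases (hf0 x).eq_or_lt with h | h
        · rw [← h, zero_mul]
          positivity
        · refine le_of_eq ?_
          rw [mul_comm (volume _).toReal, ← mul_div_assoc, mul_div_mul_left _ _ h.ne']
    _ = ∑' y : Set.range q, ν (q ⁻¹' {y.1}) / volume (q ⁻¹' {y.1}) * volume (q ⁻¹' {y.1}) :=
        lintegral_comp_eq_tsum hq hc volume fun y => ν (q ⁻¹' {y}) / volume (q ⁻¹' {y})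
    _ ≤ ∑' y : Set.range q, ν (q ⁻¹' {y.1}) := by
        refine ENNReal.tsum_le_tsum fun y => ?_
        rw [mul_comm]
        exact ENNReal.mul_div_le
    _ = 1 := by rw [tsum_fiber_eq hq hc, measure_univ]

/-- On a single cell `C`, the logarithm is at most `log e` times `μ(C \ 𝒳) / μ(C ∩ 𝒳)`, while `ν C ≤
(sup f) μ(C ∩ 𝒳)`. The factor `μ(C ∩ 𝒳)` cancels, and the sets `C \ 𝒳` of cells of positive mass
lie, up to null sets, in disjoint pieces of the collar. -/
theorem lintegral_logb_volume_ratio_le (h𝒳 : MeasurableSet 𝒳)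
    (hf𝒳 : ∀ x, x ∉ 𝒳 → f x = 0) {ν : Measure (E n)} [IsProbabilityMeasure ν]
    (hν : ν = volume.withDensity fun x => ENNReal.ofReal (f x)) (hq : Measurable q)
    (hc : (Set.range q).Countable) (hfin : ∀ x, volume (q ⁻¹' {q x}) ≠ ⊤)
    (hdiam : ∀ᵐ x, ∀ᵐ x', q x' = q x → ‖x - x'‖ ≤ ε) :
    ∫⁻ x, ENNReal.ofReal (Real.logb 2 ((volume (q ⁻¹' {q x})).toReal /
        (volume.restrict 𝒳 (q ⁻¹' {q x})).toReal)) ∂ν ≤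
      ENNReal.ofReal (Real.logb 2 (Real.exp 1)) * (⨆ x ∈ 𝒳, ENNReal.ofReal (f x)) *
        volume ((𝒳 + Metric.closedBall (0 : E n) ε) \ 𝒳) := by
  set W := (𝒳 + Metric.closedBall (0 : E n) ε) \ 𝒳
  set σ := ⨆ x ∈ 𝒳, ENNReal.ofReal (f x)
  rw [lintegral_comp_eq_tsum hq hc ν fun y => ENNReal.ofReal (Real.logb 2
    ((volume (q ⁻¹' {y})).toReal / (volume.restrict 𝒳 (q ⁻¹' {y})).toReal))]
  have hW : volume W = ∑' y : Set.range q, volume.restrict W (q ⁻¹' {y.1}) := by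
    rw [tsum_fiber_eq hq hc, Measure.restrict_apply_univ]
  rw [hW, ← ENNReal.tsum_mul_left]
  refine ENNReal.tsum_le_tsum fun ⟨y, x₁, hx₁⟩ => ?_
  simp only
  have hC : MeasurableSet (q ⁻¹' {y}) := hq (measurableSet_singleton y)
  have hCfin : volume (q ⁻¹' {y}) ≠ ⊤ := hx₁ ▸ hfin x₁
  rw [Measure.restrict_apply hC, Measure.restrict_apply hC]
  set C := q ⁻¹' {y} with hCdef
  rcases eq_or_ne (ν C) 0 with h0 | h0
  · rw [h0, mul_zero]
    exact zero_le
  have hνC : ν C ≤ σ * volume (C ∩ 𝒳) := by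
    have h1 : ν C = ∫⁻ x in C ∩ 𝒳, ENNReal.ofReal (f x) := by
      rw [hν, withDensity_apply _ hC, ← lintegral_indicator hC,
        ← lintegral_indicator (hC.inter h𝒳)]
      refine lintegral_congr fun x => ?_
      by_cases hx : x ∈ 𝒳 <;> by_cases hx' : x ∈ C <;> simp [hx, hx', hf𝒳]
    rw [h1, ← setLIntegral_const]
    refine setLIntegral_mono measurable_const fun x hx => ?_
    exact le_iSup₂ (f := fun x (_ : x ∈ 𝒳) => ENNReal.ofReal (f x)) x hx.2
  have hM0 : volume (C ∩ 𝒳) ≠ 0 := fun h => h0 (by simpa [h] using hνC)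
  have hM1 : volume (C ∩ 𝒳) ≠ ⊤ := measure_ne_top_of_subset Set.inter_subset_left hCfin
  have hD1 : volume (C \ 𝒳) ≠ ⊤ := measure_ne_top_of_subset Set.sdiff_subset hCfin
  have hsub : volume (C \ 𝒳) ≤ volume (C ∩ W) := by
    -- The diameter bound holds only for almost every centre; since `C ∩ 𝒳` has positive volume, it
    -- contains a good one.
    obtain ⟨x₀, hx₀, hx₀'⟩ : ∃ x₀ ∈ C ∩ 𝒳, ∀ᵐ x', q x' = q x₀ → ‖x₀ - x'‖ ≤ ε := by
      by_contra hcon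
      refine hM0 (measure_mono_null (fun x hx => ?_) hdiam)
      exact fun hgood => hcon ⟨x, hx, hgood⟩
    refine measure_mono_ae ?_
    filter_upwards [hx₀'] with x' h1 h2
    have h3 : ‖x₀ - x'‖ ≤ ε := h1 ((Set.mem_singleton_iff.1 h2.1).trans
      (Set.mem_singleton_iff.1 hx₀.1).symm)
    refine ⟨h2.1, ⟨x₀, hx₀.2, x' - x₀, ?_, by simp⟩, h2.2⟩
    rwa [mem_closedBall_zero_iff, norm_sub_rev]
  have hMpos := ENNReal.toReal_pos hM0 hM1
  have hlog : Real.logb 2 ((volume C).toReal / (volume (C ∩ 𝒳)).toReal) ≤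
      Real.logb 2 (Real.exp 1) * (volume (C \ 𝒳) / volume (C ∩ 𝒳)).toReal := by
    have hsum : (volume C).toReal = (volume (C ∩ 𝒳)).toReal + (volume (C \ 𝒳)).toReal := by
      rw [← ENNReal.toReal_add hM1 hD1, measure_inter_add_sdiff C h𝒳]
    have hpos : 0 < (volume C).toReal / (volume (C ∩ 𝒳)).toReal := by
      have := ENNReal.toReal_nonneg (a := volume (C \ 𝒳))
      rw [hsum]
      positivity
    refine (logb_two_le_mul_sub_one hpos).trans (le_of_eq ?_)
    rw [ENNReal.toReal_div, hsum]
    field_simp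
    ring
  calc _ ≤ ENNReal.ofReal (Real.logb 2 (Real.exp 1)) * (volume (C \ 𝒳) / volume (C ∩ 𝒳)) *
        (σ * volume (C ∩ 𝒳)) := by
        refine mul_le_mul' ((ENNReal.ofReal_le_ofReal hlog).trans ?_) hνC
        rw [ENNReal.ofReal_mul logb_two_exp_one_pos.le]
        exact mul_le_mul_right ENNReal.ofReal_toReal_le _
    _ = ENNReal.ofReal (Real.logb 2 (Real.exp 1)) * σ *
        (volume (C \ 𝒳) / volume (C ∩ 𝒳) * volume (C ∩ 𝒳)) := by ring
    _ = ENNReal.ofReal (Real.logb 2 (Real.exp 1)) * σ * volume (C \ 𝒳) := by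
        rw [ENNReal.div_mul_cancel hM0 hM1]
    _ ≤ _ := mul_le_mul_right hsub _

end

section

/-! ### Quantizers with bounded cells and stationary mean log-volume -/

theorem ae_prod_of_ae_ae_swap {α β : Type*} [MeasurableSpace α] [MeasurableSpace β]
    {μ : Measure α} {ν : Measure β} [SFinite μ] [SFinite ν] {p : α × β → Prop}
    (hp : MeasurableSet {z | p z}) (h : ∀ᵐ y ∂ν, ∀ᵐ x ∂μ, p (x, y)) : ∀ᵐ z ∂μ.prod ν, p z :=
  (Measure.ae_prod_iff_ae_ae hp).2 ((Measure.ae_ae_comm (p := fun x y => p (x, y)) hp).2 h)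

theorem lintegral_prod_comp_fst {n : ℕ} {Q : RandomizedQuantizer n}
    {ν : Measure (E n)} [SFinite ν] {g : E n → ℝ≥0∞} (hg : Measurable g) :
    ∫⁻ p, g p.1 ∂(ν.prod Q.law) = ∫⁻ x, g x ∂ν := by
  rw [lintegral_prod (fun p => g p.1) (hg.comp measurable_fst).aemeasurable]
  simp

/-- Almost surely, the cells of `Q` have volume at most `a` and diameter at most `ε`, and the mean of
`log (a / μ(cell of x))` is `ℓ` for every `x`. -/
structure StationaryCells {n : ℕ} (Q : RandomizedQuantizer n) (ε : ℝ) (a ℓ : ℝ≥0∞) : Prop where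
  a_ne_zero : a ≠ 0
  a_ne_top : a ≠ ⊤
  volume_le : ∀ᵐ s ∂Q.law, ∀ x, Q.cellMass volume x s ≤ a
  diam_le : ∀ᵐ s ∂Q.law, ∀ᵐ x, ∀ᵐ x', Q.toFun x' s = Q.toFun x s → ‖x - x'‖ ≤ ε
  lintegral_logb : ∀ x, ∫⁻ s, ENNReal.ofReal
    (Real.logb 2 (a.toReal / (Q.cellMass volume x s).toReal)) ∂Q.law = ℓ

variable {n : ℕ} {Q : RandomizedQuantizer n} {ε : ℝ} {a ℓ : ℝ≥0∞} {f : E n → ℝ}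
  {ν : Measure (E n)} [IsProbabilityMeasure ν]

theorem StationaryCells.measurable_logb_volume (_hQ : StationaryCells Q ε a ℓ) :
    Measurable fun p : E n × Q.State => ENNReal.ofReal
      (Real.logb 2 (a.toReal / (Q.cellMass volume p.1 p.2).toReal)) :=
  (measurable_const.div (Q.measurable_cellMass volume).ennreal_toReal).real_logb.ennreal_ofReal

theorem StationaryCells.lintegral_prod_logb (hQ : StationaryCells Q ε a ℓ) :
    ∫⁻ p, ENNReal.ofReal (Real.logb 2 (a.toReal / (Q.cellMass volume p.1 p.2).toReal))
      ∂(ν.prod Q.law) = ℓ := by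
  rw [lintegral_prod _ hQ.measurable_logb_volume.aemeasurable]
  simp [hQ.lintegral_logb]

theorem toReal_cellMass_le_one (x : E n) (s : Q.State) : (Q.cellMass ν x s).toReal ≤ 1 :=
  ENNReal.toReal_mono ENNReal.one_ne_top prob_le_one

theorem ae_cellMass_ne_zero : ∀ᵐ p ∂(ν.prod Q.law), Q.cellMass ν p.1 p.2 ≠ 0 := by
  refine ae_prod_of_ae_ae_swap ?_ (Eventually.of_forall fun s => ?_)
  · exact ((Q.measurable_cellMass ν) (measurableSet_singleton 0)).compl
  · exact ae_fiber_ne_zero (Q.countable_range s) ν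

theorem StationaryCells.ae_volume_le (hQ : StationaryCells Q ε a ℓ) :
    ∀ᵐ p ∂(ν.prod Q.law), Q.cellMass volume p.1 p.2 ≤ a := by
  refine ae_prod_of_ae_ae_swap ?_ (hQ.volume_le.mono fun s hs => Eventually.of_forall hs)
  exact (Q.measurable_cellMass volume) measurableSet_Iic

theorem StationaryCells.ae_diam_le (hQ : StationaryCells Q ε a ℓ) (hν : ν ≪ volume) :
    ∀ᵐ p ∂(ν.prod Q.law), ∀ᵐ x', Q.toFun x' p.2 = Q.toFun p.1 p.2 → ‖p.1 - x'‖ ≤ ε := by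
  refine ae_prod_of_ae_ae_swap ?_ (hQ.diam_le.mono fun s hs => hν.ae_le hs)
  -- The inner a.e. statement says that a section of this bad set is null, and the volume of a
  -- section depends measurably on `p`.
  have hset : MeasurableSet {z : (E n × Q.State) × E n |
      Q.toFun z.2 z.1.2 = Q.toFun z.1.1 z.1.2 ∧ ε < ‖z.1.1 - z.2‖} := by
    have h1 : MeasurableSet {z : (E n × Q.State) × E n |
        Q.toFun z.2 z.1.2 = Q.toFun z.1.1 z.1.2} := measurableSet_eq_fun
      (Q.measurable_toFun.comp (measurable_snd.prodMk (measurable_snd.comp measurable_fst)))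
      (Q.measurable_toFun.comp measurable_fst)
    have h2 : MeasurableSet {z : (E n × Q.State) × E n | ε < ‖z.1.1 - z.2‖} :=
      measurableSet_lt measurable_const
        ((measurable_fst.comp measurable_fst).sub measurable_snd).norm
    exact h1.inter h2
  have := measurable_measure_prodMk_left (ν := (volume : Measure (E n))) hset
    (measurableSet_singleton 0)
  convert this using 1
  ext p
  simp only [Set.mem_ofPred_eq, Set.mem_preimage, Set.mem_singleton_iff, ae_iff]
  simp only [Classical.not_imp, not_le]
  rfl

/-- Integrated form of `information_lower_bound`: the last term has mean at most `κ = log e`, which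
cancels the `κ` on the left. -/
theorem StationaryCells.lower_bound (hQ : StationaryCells Q ε a ℓ) (hf : Measurable f)
    (hf0 : ∀ x, 0 ≤ f x) (hν : ν = volume.withDensity fun x => ENNReal.ofReal (f x)) :
    diffEntropyPos f + ℓ + ENNReal.ofReal (-Real.logb 2 a.toReal) ≤
      diffEntropyNeg f + ENNReal.ofReal (Real.logb 2 a.toReal) +
        ∫⁻ p, ENNReal.ofReal (-Real.logb 2 (Q.cellMass ν p.1 p.2).toReal) ∂(ν.prod Q.law) := by
  set κ := ENNReal.ofReal (Real.logb 2 (Real.exp 1)) with hκ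
  have hκtop : κ ≠ ⊤ := ENNReal.ofReal_ne_top
  have hmt : Measurable fun p : E n × Q.State => f p.1 := hf.comp measurable_fst
  have hmN := (Q.measurable_cellMass ν).ennreal_toReal
  have hmM := (Q.measurable_cellMass volume).ennreal_toReal
  have hpt : ∀ᵐ p ∂(ν.prod Q.law),
      ENNReal.ofReal (-Real.logb 2 (f p.1)) + ENNReal.ofReal
          (Real.logb 2 (a.toReal / (Q.cellMass volume p.1 p.2).toReal))
        + ENNReal.ofReal (-Real.logb 2 a.toReal) + κ ≤
      ENNReal.ofReal (Real.logb 2 (f p.1)) + ENNReal.ofReal (Real.logb 2 a.toReal)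
        + ENNReal.ofReal (-Real.logb 2 (Q.cellMass ν p.1 p.2).toReal)
        + κ * ENNReal.ofReal ((Q.cellMass ν p.1 p.2).toReal /
          ((Q.cellMass volume p.1 p.2).toReal * f p.1)) := by
    have hac : ν ≪ volume := hν ▸ withDensity_absolutelyContinuous _ _
    have hfpos : ∀ᵐ x ∂ν, 0 < f x := by
      rw [hν]
      exact ae_pos_withDensity hf
    filter_upwards [Measure.quasiMeasurePreserving_fst.ae hfpos, ae_cellMass_ne_zero,
      hQ.ae_volume_le] with p h1 h2 h3
    have hM0 : Q.cellMass volume p.1 p.2 ≠ 0 := fun h => h2 (hac h)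
    refine information_lower_bound h1 (ENNReal.toReal_pos h2 (measure_ne_top _ _)) ?_
      (ENNReal.toReal_pos hM0 (ne_top_of_le_ne_top hQ.a_ne_top h3))
      (ENNReal.toReal_mono hQ.a_ne_top h3)
    exact toReal_cellMass_le_one _ _
  have hint := lintegral_mono_ae hpt
  rw [lintegral_add_right _ measurable_const, lintegral_add_right _ measurable_const,
    lintegral_add_right _ hQ.measurable_logb_volume, hQ.lintegral_prod_logb,
    lintegral_add_left, lintegral_add_left, lintegral_add_left hmt.real_logb.ennreal_ofReal,
    lintegral_const_mul' _ _ hκtop] at hint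
  rotate_left
  · exact hmt.real_logb.ennreal_ofReal.add_const _
  · exact (hmt.real_logb.ennreal_ofReal.add_const _).add hmN.real_logb.neg.ennreal_ofReal
  have e3 : ∫⁻ p : E n × Q.State, ENNReal.ofReal ((Q.cellMass ν p.1 p.2).toReal /
          ((Q.cellMass volume p.1 p.2).toReal * f p.1)) ∂(ν.prod Q.law) ≤ 1 := by
    have hm : Measurable fun p : E n × Q.State => ENNReal.ofReal ((Q.cellMass ν p.1 p.2).toReal /
          ((Q.cellMass volume p.1 p.2).toReal * f p.1)) := (hmN.div (hmM.mul hmt)).ennreal_ofReal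
    rw [lintegral_prod_symm _ hm.aemeasurable]
    calc _ ≤ ∫⁻ _, 1 ∂Q.law := lintegral_mono fun s =>
          lintegral_mass_div_volume_le hf hf0 hν (Q.measurable_section s) (Q.countable_range s)
      _ = 1 := by simp
  rw [lintegral_prod_comp_fst (g := fun x => ENNReal.ofReal (-Real.logb 2 (f x)))
      hf.real_logb.neg.ennreal_ofReal,
    lintegral_prod_comp_fst (g := fun x => ENNReal.ofReal (Real.logb 2 (f x)))
      hf.real_logb.ennreal_ofReal, hν, ← diffEntropyPos_eq hf hf0, ← diffEntropyNeg_eq hf hf0,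
    ← hν] at hint
  simp only [lintegral_const, measure_univ, mul_one] at hint
  have hfin := hint.trans (add_le_add_right (mul_le_mul_right e3 κ) _)
  rw [mul_one] at hfin
  exact (ENNReal.add_le_add_iff_right hκtop).1 hfin

/-- Integrated form of `information_upper_bound`. The two error terms `θ` (oscillation of `f` within
a cell) and `η` (part of a cell outside `𝒳`) yield the two summands of `deltaBar`. -/
theorem StationaryCells.upper_bound (hQ : StationaryCells Q ε a ℓ) (hf : Measurable f)
    (hf0 : ∀ x, 0 ≤ f x) {𝒳 : Set (E n)} (h𝒳 : MeasurableSet 𝒳) (hf𝒳 : ∀ x, x ∉ 𝒳 → f x = 0)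
    (hν : ν = volume.withDensity fun x => ENNReal.ofReal (f x)) :
    (∫⁻ p, ENNReal.ofReal (-Real.logb 2 (Q.cellMass ν p.1 p.2).toReal) ∂(ν.prod Q.law)) +
        diffEntropyNeg f + ENNReal.ofReal (Real.logb 2 a.toReal) ≤
      diffEntropyPos f + ℓ + ENNReal.ofReal (-Real.logb 2 a.toReal) + deltaBar f 𝒳 ε := by
  have hmt : Measurable fun p : E n × Q.State => f p.1 := hf.comp measurable_fst
  have hmN := (Q.measurable_cellMass ν).ennreal_toReal
  have hmM := (Q.measurable_cellMass volume).ennreal_toReal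
  have hmM' := (Q.measurable_cellMass (volume.restrict 𝒳)).ennreal_toReal
  set θ : E n × Q.State → ℝ≥0∞ := fun p => ENNReal.ofReal (Real.logb 2
    (f p.1 * (Q.cellMass (volume.restrict 𝒳) p.1 p.2).toReal / (Q.cellMass ν p.1 p.2).toReal))
    with hθ
  set η : E n × Q.State → ℝ≥0∞ := fun p => ENNReal.ofReal (Real.logb 2
    ((Q.cellMass volume p.1 p.2).toReal / (Q.cellMass (volume.restrict 𝒳) p.1 p.2).toReal))
    with hη
  have hmθ : Measurable θ := ((hmt.mul hmM').div hmN).real_logb.ennreal_ofReal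
  have hmη : Measurable η := (hmM.div hmM').real_logb.ennreal_ofReal
  have hmθη : Measurable fun p => θ p + η p := hmθ.add hmη
  have hac : ν ≪ volume := hν ▸ withDensity_absolutelyContinuous _ _
  -- Ensures that a cell of positive mass meets `𝒳` in positive volume, so the ratios in `θ` and `η`
  -- are genuine.
  have hac' : ν ≪ volume.restrict 𝒳 := by
    refine Measure.AbsolutelyContinuous.mk fun C hC h0 => ?_
    rw [Measure.restrict_apply hC] at h0
    have h1 : ν (C ∩ 𝒳) = 0 := hac h0
    have h2 : ν (C \ 𝒳) = 0 := by
      rw [hν, withDensity_apply _ (hC.diff h𝒳), setLIntegral_congr_fun (g := fun _ => 0)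
        (hC.diff h𝒳)]
      · simp
      · intro x hx
        simp [hf𝒳 x hx.2]
    rw [← measure_inter_add_sdiff C h𝒳, h1, h2, add_zero]
  have hfpos : ∀ᵐ x ∂ν, 0 < f x := by
    rw [hν]
    exact ae_pos_withDensity hf
  have hgood : ∀ᵐ p ∂(ν.prod Q.law), 0 < f p.1 ∧ Q.cellMass ν p.1 p.2 ≠ 0 ∧
      Q.cellMass volume p.1 p.2 ≤ a ∧ Q.cellMass (volume.restrict 𝒳) p.1 p.2 ≠ 0 ∧
      Q.cellMass (volume.restrict 𝒳) p.1 p.2 ≤ Q.cellMass volume p.1 p.2 := by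
    filter_upwards [Measure.quasiMeasurePreserving_fst.ae hfpos, ae_cellMass_ne_zero,
      hQ.ae_volume_le] with p h1 h2 h3
    exact ⟨h1, h2, h3, fun h => h2 (hac' h), Measure.restrict_apply_le _ _⟩
  have hpt : ∀ᵐ p ∂(ν.prod Q.law),
      ENNReal.ofReal (-Real.logb 2 (Q.cellMass ν p.1 p.2).toReal)
        + ENNReal.ofReal (Real.logb 2 (f p.1)) + ENNReal.ofReal (Real.logb 2 a.toReal) ≤
      ENNReal.ofReal (-Real.logb 2 (f p.1)) + ENNReal.ofReal
          (Real.logb 2 (a.toReal / (Q.cellMass volume p.1 p.2).toReal))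
        + ENNReal.ofReal (-Real.logb 2 a.toReal) + (θ p + η p) := by
    filter_upwards [hgood] with p ⟨h1, h2, h3, h4, h5⟩
    have hM := ne_top_of_le_ne_top hQ.a_ne_top h3
    refine information_upper_bound h1 (ENNReal.toReal_pos h2 (measure_ne_top _ _)) ?_
      (ENNReal.toReal_pos h4 (ne_top_of_le_ne_top hM h5)) (ENNReal.toReal_mono hM h5)
      (ENNReal.toReal_mono hQ.a_ne_top h3)
    exact toReal_cellMass_le_one _ _
  have hθint : ∫⁻ p, θ p ∂(ν.prod Q.law) ≤
      ∫⁻ x in 𝒳, (deltaLocal f 𝒳 ε x).toENNReal * ENNReal.ofReal (f x) := by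
    have hθle : ∀ᵐ p ∂(ν.prod Q.law), θ p ≤ (deltaLocal f 𝒳 ε p.1).toENNReal := by
      filter_upwards [hgood, hQ.ae_diam_le hac] with p ⟨h1, h2, h3, h4, h5⟩ h6
      exact ofReal_logb_le_deltaLocal hf hf0 h𝒳 hν
        (Q.measurable_section p.2 (measurableSet_singleton _)) h1 h2 h4
        (ne_top_of_le_ne_top hQ.a_ne_top (h5.trans h3)) h6
    have h1 : ∀ᵐ x ∂ν, ∫⁻ s, θ (x, s) ∂Q.law ≤ (deltaLocal f 𝒳 ε x).toENNReal := by
      filter_upwards [Measure.ae_ae_of_ae_prod hθle] with x hx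
      calc _ ≤ ∫⁻ _, (deltaLocal f 𝒳 ε x).toENNReal ∂Q.law := lintegral_mono_ae hx
        _ = _ := by simp
    rw [lintegral_prod _ hmθ.aemeasurable, hν, lintegral_withDensity_eq_lintegral_mul _
      hf.ennreal_ofReal hmθ.lintegral_prod_right', ← lintegral_indicator h𝒳]
    rw [hν, ae_withDensity_iff hf.ennreal_ofReal] at h1
    refine lintegral_mono_ae ?_
    filter_upwards [h1] with x hx
    rw [Pi.mul_apply]
    by_cases hx0 : ENNReal.ofReal (f x) = 0
    · rw [hx0, zero_mul]
      exact zero_le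
    · have hmem : x ∈ 𝒳 := by
        by_contra h
        simp [hf𝒳 x h] at hx0
      rw [Set.indicator_of_mem hmem, mul_comm]
      exact mul_le_mul_left (hx hx0) _
  have hηint : ∫⁻ p, η p ∂(ν.prod Q.law) ≤
      ENNReal.ofReal (Real.logb 2 (Real.exp 1)) * (⨆ x ∈ 𝒳, ENNReal.ofReal (f x)) *
        volume ((𝒳 + Metric.closedBall (0 : E n) ε) \ 𝒳) := by
    rw [lintegral_prod_symm _ hmη.aemeasurable]
    calc _ ≤ ∫⁻ _, ENNReal.ofReal (Real.logb 2 (Real.exp 1)) *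
          (⨆ x ∈ 𝒳, ENNReal.ofReal (f x)) *
          volume ((𝒳 + Metric.closedBall (0 : E n) ε) \ 𝒳) ∂Q.law := by
          refine lintegral_mono_ae ?_
          filter_upwards [hQ.volume_le, hQ.diam_le] with s h1 h2
          exact lintegral_logb_volume_ratio_le h𝒳 hf𝒳 hν (Q.measurable_section s)
            (Q.countable_range s) (fun x => ne_top_of_le_ne_top hQ.a_ne_top (h1 x)) h2
      _ = _ := by simp
  have hint := lintegral_mono_ae hpt
  rw [lintegral_add_right _ measurable_const,
    lintegral_add_right _ hmt.real_logb.ennreal_ofReal, lintegral_add_right _ hmθη,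
    lintegral_add_right _ hmη, lintegral_add_right _ measurable_const,
    lintegral_add_right _ hQ.measurable_logb_volume, hQ.lintegral_prod_logb] at hint
  rw [lintegral_prod_comp_fst (g := fun x => ENNReal.ofReal (-Real.logb 2 (f x)))
      hf.real_logb.neg.ennreal_ofReal,
    lintegral_prod_comp_fst (g := fun x => ENNReal.ofReal (Real.logb 2 (f x)))
      hf.real_logb.ennreal_ofReal, hν, ← diffEntropyPos_eq hf hf0, ← diffEntropyNeg_eq hf hf0,
    ← hν] at hint
  simp only [lintegral_const, measure_univ, mul_one] at hint
  exact hint.trans (add_le_add_right (add_le_add hθint hηint) _)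

end

section

/-! ### Entropy bounds in the extended reals -/

/-- If `H = ⊤` or `m = ⊤` the claim is trivial; otherwise `h` forces `p` to be finite and everything
is real arithmetic. -/
theorem add_sub_le_of_add_le {p m ℓ H : ℝ≥0∞} {b : ℝ} (hℓ : ℓ ≠ ⊤) (hpm : p ≠ ⊤ ∨ m ≠ ⊤)
    (h : p + ℓ + ENNReal.ofReal (-b) ≤ m + ENNReal.ofReal b + H) :
    ((ℓ.toReal - b : ℝ) : EReal) + ((p : EReal) - (m : EReal)) ≤ (H : EReal) := by
  rcases eq_or_ne H ⊤ with rfl | hH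
  · simp
  rcases eq_or_ne m ⊤ with rfl | hm
  · lift p to NNReal using hpm.resolve_right (by simp)
    have : ((p : ℝ≥0∞) : EReal) - ((⊤ : ℝ≥0∞) : EReal) = ⊥ := by
      simp
    rw [this, EReal.add_bot]
    exact bot_le
  have hp : p ≠ ⊤ := by
    rintro rfl
    rw [top_add, top_add, top_le_iff] at h
    exact absurd h (by finiteness)
  lift p to NNReal using hp
  lift m to NNReal using hm
  lift H to NNReal using hH
  lift ℓ to NNReal using hℓ
  obtain ⟨b₁, b₂, h₁, h₂, rfl, e₁, e₂⟩ := exists_pos_neg_parts b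
  rw [e₁, e₂] at h
  lift b₁ to NNReal using h₁
  lift b₂ to NNReal using h₂
  simp only [ENNReal.ofReal_coe_nnreal] at h
  norm_cast at h
  have h' : (p : ℝ) + ℓ + b₂ ≤ m + b₁ + H := by exact_mod_cast h
  simp only [ENNReal.coe_toReal, EReal.coe_nnreal_eq_coe_real, ← EReal.coe_sub, ← EReal.coe_add,
    EReal.coe_le_coe_iff]
  linarith

theorem le_add_sub_of_add_le {p m ℓ H D : ℝ≥0∞} {b : ℝ} (hℓ : ℓ ≠ ⊤) (hD : D ≠ ⊤)
    (hpm : p ≠ ⊤ ∨ m ≠ ⊤)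
    (h : H + m + ENNReal.ofReal b ≤ p + ℓ + ENNReal.ofReal (-b) + D) :
    (H : EReal) ≤ ((ℓ.toReal - b : ℝ) : EReal) + ((p : EReal) - (m : EReal)) + (D : EReal) := by
  lift D to NNReal using hD
  rcases eq_or_ne p ⊤ with rfl | hp
  · lift m to NNReal using hpm.resolve_left (by simp)
    have : ((⊤ : ℝ≥0∞) : EReal) - ((m : ℝ≥0∞) : EReal) = ⊤ := by
      rw [EReal.coe_nnreal_eq_coe_real, EReal.coe_ennreal_top, EReal.top_sub_coe]
    rw [this, EReal.coe_nnreal_eq_coe_real, EReal.coe_add_top, EReal.top_add_coe]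
    exact le_top
  have hm : m ≠ ⊤ := by
    rintro rfl
    rw [add_top, top_add, top_le_iff] at h
    exact absurd h (by finiteness)
  have hH : H ≠ ⊤ := by
    rintro rfl
    rw [top_add, top_add, top_le_iff] at h
    exact absurd h (by finiteness)
  lift p to NNReal using hp
  lift m to NNReal using hm
  lift H to NNReal using hH
  lift ℓ to NNReal using hℓ
  obtain ⟨b₁, b₂, h₁, h₂, rfl, e₁, e₂⟩ := exists_pos_neg_parts b
  rw [e₁, e₂] at h
  lift b₁ to NNReal using h₁
  lift b₂ to NNReal using h₂
  simp only [ENNReal.ofReal_coe_nnreal] at h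
  norm_cast at h
  have h' : (H : ℝ) + m + b₁ ≤ p + ℓ + b₂ + D := by exact_mod_cast h
  simp only [ENNReal.coe_toReal, EReal.coe_nnreal_eq_coe_real, ← EReal.coe_sub, ← EReal.coe_add,
    EReal.coe_le_coe_iff]
  linarith

variable {n : ℕ} {Q : RandomizedQuantizer n} {ε : ℝ} {a ℓ : ℝ≥0∞} {f : E n → ℝ}
  {Ω : Type*} [MeasurableSpace Ω] {μ : Measure Ω} [IsProbabilityMeasure μ]
  {X : Ω → E n} {S : Ω → Q.State}

theorem StationaryCells.le_condEntropy (hQ : StationaryCells Q ε a ℓ) (hℓ : ℓ ≠ ⊤)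
    (hf : Measurable f) (hf0 : ∀ x, 0 ≤ f x) (hh : DiffEntropyExists f)
    (hX : HasLaw X (volume.withDensity fun x => ENNReal.ofReal (f x)) μ)
    (hS : HasLaw S Q.law μ) (hXS : IndepFun X S μ) :
    ((ℓ.toReal - Real.logb 2 a.toReal : ℝ) : EReal) + diffEntropy f ≤
      (condEntropy (fun ω => Q.toFun (X ω) (S ω)) S μ : EReal) := by
  have := hX.isProbabilityMeasure_iff.1 inferInstance
  rw [condEntropy_eq Q hX hS hXS]
  exact add_sub_le_of_add_le hℓ hh (hQ.lower_bound hf hf0 rfl)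

theorem StationaryCells.condEntropy_le (hQ : StationaryCells Q ε a ℓ) (hℓ : ℓ ≠ ⊤)
    (hf : Measurable f) (hf0 : ∀ x, 0 ≤ f x) {𝒳 : Set (E n)} (h𝒳 : MeasurableSet 𝒳)
    (hf𝒳 : ∀ x, x ∉ 𝒳 → f x = 0) (hh : DiffEntropyExists f)
    (hX : HasLaw X (volume.withDensity fun x => ENNReal.ofReal (f x)) μ)
    (hS : HasLaw S Q.law μ) (hXS : IndepFun X S μ) (hδ : deltaBar f 𝒳 ε ≠ ⊤) :
    (condEntropy (fun ω => Q.toFun (X ω) (S ω)) S μ : EReal) ≤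
      ((ℓ.toReal - Real.logb 2 a.toReal : ℝ) : EReal) + diffEntropy f
        + (deltaBar f 𝒳 ε : EReal) := by
  have := hX.isProbabilityMeasure_iff.1 inferInstance
  rw [condEntropy_eq Q hX hS hXS]
  exact le_add_sub_of_add_le hℓ hδ hh (hQ.upper_bound hf hf0 h𝒳 hf𝒳 rfl)

/-! ### Uniform densities and the normalized entropy -/

/-- The density of the uniform distribution on `B`. -/
def uniformDensity (B : Set (E n)) : E n → ℝ :=
  B.indicator fun _ => (volume.real B)⁻¹

variable {B : Set (E n)}

theorem measurable_uniformDensity (hB : MeasurableSet B) : Measurable (uniformDensity B) :=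
  measurable_const.indicator hB

theorem uniformDensity_nonneg (x : E n) : 0 ≤ uniformDensity B x :=
  Set.indicator_nonneg (fun _ _ => inv_nonneg.2 measureReal_nonneg) x

theorem withDensity_uniformDensity (hB : MeasurableSet B) (h0 : volume B ≠ 0)
    (h1 : volume B ≠ ⊤) :
    volume.withDensity (fun x => ENNReal.ofReal (uniformDensity B x)) =
      ProbabilityTheory.cond volume B := by
  have : (fun x => ENNReal.ofReal (uniformDensity B x)) =
      B.indicator fun _ => (volume B)⁻¹ := by
    ext x
    by_cases hx : x ∈ B
    · rw [uniformDensity, Set.indicator_of_mem hx, Set.indicator_of_mem hx,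
        ENNReal.ofReal_inv_of_pos (show 0 < volume.real B from ENNReal.toReal_pos h0 h1),
        ofReal_measureReal h1]
    · simp [uniformDensity, hx]
  rw [this, withDensity_indicator hB, withDensity_const]
  rfl

theorem diffEntropy_uniformDensity (hB : MeasurableSet B) (h0 : volume B ≠ 0)
    (h1 : volume B ≠ ⊤) : DiffEntropyExists (uniformDensity B) ∧
      diffEntropy (uniformDensity B) = ((Real.logb 2 (volume.real B) : ℝ) : EReal) := by
  have hprob := cond_isProbabilityMeasure_of_finite h0 h1
  have hae : ∀ᵐ x ∂(ProbabilityTheory.cond volume B),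
      uniformDensity B x = (volume.real B)⁻¹ := by
    filter_upwards [ae_cond_mem hB] with x hx
    exact Set.indicator_of_mem hx _
  have hpos : diffEntropyPos (uniformDensity B) =
      ENNReal.ofReal (Real.logb 2 (volume.real B)) := by
    rw [diffEntropyPos_eq (measurable_uniformDensity hB) uniformDensity_nonneg,
      withDensity_uniformDensity hB h0 h1,
      lintegral_congr_ae (hae.mono fun x hx => by rw [hx, Real.logb_inv, neg_neg])]
    simp
  have hneg : diffEntropyNeg (uniformDensity B) =
      ENNReal.ofReal (-Real.logb 2 (volume.real B)) := by
    rw [diffEntropyNeg_eq (measurable_uniformDensity hB) uniformDensity_nonneg,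
      withDensity_uniformDensity hB h0 h1,
      lintegral_congr_ae (hae.mono fun x hx => by rw [hx, Real.logb_inv])]
    simp
  refine ⟨Or.inl (hpos ▸ ENNReal.ofReal_ne_top), ?_⟩
  obtain ⟨p, m, hp, hm, e1, e2, e3⟩ := exists_pos_neg_parts (Real.logb 2 (volume.real B))
  rw [diffEntropy, hpos, hneg, e2, e3, e1, EReal.coe_ennreal_ofReal, EReal.coe_ennreal_ofReal,
    max_eq_left hp, max_eq_left hm, EReal.coe_sub]

/-- A constant density has no oscillation inside `B`, so only the collar term survives. -/
theorem deltaBar_uniformDensity_le (hB : MeasurableSet B) (h0 : volume B ≠ 0)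
    (h1 : volume B ≠ ⊤) (ε : ℝ) :
    deltaBar (uniformDensity B) B ε ≤ ENNReal.ofReal (Real.logb 2 (Real.exp 1)) *
      ENNReal.ofReal (volume.real B)⁻¹ * volume ((B + Metric.closedBall (0 : E n) ε) \ B) := by
  have hval : ∀ x ∈ B, uniformDensity B x = (volume.real B)⁻¹ := fun x hx =>
    Set.indicator_of_mem hx _
  have hpos : 0 < (volume.real B)⁻¹ := inv_pos.2 (ENNReal.toReal_pos h0 h1)
  have hδ : ∀ x ∈ B, (deltaLocal (uniformDensity B) B ε x).toENNReal = 0 := by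
    intro x hx
    refine EReal.toENNReal_of_nonpos (iSup₂_le fun x' hx' => ?_)
    rw [hval x hx, hval x' hx'.1, ENNReal.div_self (by simpa using hpos) ENNReal.ofReal_ne_top]
    simp [log2]
  rw [deltaBar, setLIntegral_congr_fun (g := fun _ => 0) hB fun x hx => by
    simp only [hδ x hx, zero_mul], lintegral_zero, zero_add]
  gcongr
  exact iSup₂_le fun x hx => by rw [hval x hx]

theorem deltaBar_uniformDensity_closedBall_le (hε : 0 ≤ ε) {τ : ℝ} (hτ : 0 < τ) :
    deltaBar (uniformDensity (Metric.closedBall (0 : E n) τ)) (Metric.closedBall 0 τ) ε ≤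
      ENNReal.ofReal (Real.logb 2 (Real.exp 1) * (((τ + ε) / τ) ^ n - 1)) := by
  set c := volume.real (Metric.ball (0 : E n) 1)
  have hc : 0 < c := ENNReal.toReal_pos (Metric.measure_ball_pos volume _ one_pos).ne'
    measure_ball_lt_top.ne
  have hvol : ∀ r : ℝ, 0 ≤ r → volume (Metric.closedBall (0 : E n) r) =
      ENNReal.ofReal (r ^ n * c) := by
    intro r hr
    rw [Measure.addHaar_closedBall _ _ hr, ENNReal.ofReal_mul (by positivity),
      ofReal_measureReal measure_ball_lt_top.ne]
    simp
  have h0 : volume (Metric.closedBall (0 : E n) τ) ≠ 0 :=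
    (Metric.measure_closedBall_pos volume _ hτ).ne'
  have h1 : volume (Metric.closedBall (0 : E n) τ) ≠ ⊤ := measure_closedBall_lt_top.ne
  refine (deltaBar_uniformDensity_le measurableSet_closedBall h0 h1 ε).trans ?_
  have hsub : volume ((Metric.closedBall (0 : E n) τ + Metric.closedBall (0 : E n) ε) \
      Metric.closedBall 0 τ) ≤ ENNReal.ofReal ((τ + ε) ^ n * c - τ ^ n * c) := by
    have h2 : (Metric.closedBall (0 : E n) τ + Metric.closedBall (0 : E n) ε) ⊆
        Metric.closedBall 0 (τ + ε) := by
      rintro _ ⟨x, hx, y, hy, rfl⟩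
      rw [mem_closedBall_zero_iff] at *
      exact (norm_add_le x y).trans (add_le_add hx hy)
    refine (measure_mono (Set.sdiff_subset_sdiff_left h2)).trans (le_of_eq ?_)
    rw [measure_sdiff (Metric.closedBall_subset_closedBall (by linarith))
      measurableSet_closedBall.nullMeasurableSet h1, hvol _ (by positivity), hvol _ hτ.le,
      ENNReal.ofReal_sub _ (by positivity)]
  have hreal : volume.real (Metric.closedBall (0 : E n) τ) = τ ^ n * c := by
    rw [Measure.real, hvol _ hτ.le, ENNReal.toReal_ofReal (by positivity)]
  refine (mul_le_mul_right hsub _).trans (le_of_eq ?_)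
  rw [hreal, ← ENNReal.ofReal_mul logb_two_exp_one_pos.le,
    ← ENNReal.ofReal_mul (mul_nonneg logb_two_exp_one_pos.le (by positivity))]
  congr 1
  rw [div_pow]
  field_simp

/-- Both entropy bounds are applied to the uniform law on a ball of radius `τ`, whose differential
entropy is the subtracted log-volume. The gap is a constant times `((τ + ε) / τ) ^ n - 1`, which
vanishes in the limit, so the `limsup` is a limit. -/
theorem StationaryCells.normalizedEntropy_eq (hQ : StationaryCells Q ε a ℓ) (hℓ : ℓ ≠ ⊤)
    (hε : 0 ≤ ε) :
    Q.normalizedEntropy = ((ℓ.toReal - Real.logb 2 a.toReal : ℝ) : EReal) := by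
  set l : ℝ := ℓ.toReal - Real.logb 2 a.toReal
  have hbound : ∀ τ : ℝ, 0 < τ →
      (l : EReal) ≤ (condEntropy (fun p : E n × Q.State => Q.toFun p.1 p.2) (fun p => p.2)
        ((ProbabilityTheory.cond (volume : Measure (E n)) (Metric.closedBall 0 τ)).prod Q.law)
          : EReal) - log2 (volume (Metric.closedBall (0 : E n) τ)) ∧
      (condEntropy (fun p : E n × Q.State => Q.toFun p.1 p.2) (fun p => p.2)
        ((ProbabilityTheory.cond (volume : Measure (E n)) (Metric.closedBall 0 τ)).prod Q.law)
          : EReal) - log2 (volume (Metric.closedBall (0 : E n) τ)) ≤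
        ((l + Real.logb 2 (Real.exp 1) * (((τ + ε) / τ) ^ n - 1) : ℝ) : EReal) := by
    intro τ hτ
    have hB : MeasurableSet (Metric.closedBall (0 : E n) τ) := measurableSet_closedBall
    have h0 : volume (Metric.closedBall (0 : E n) τ) ≠ 0 :=
      (Metric.measure_closedBall_pos volume _ hτ).ne'
    have h1 : volume (Metric.closedBall (0 : E n) τ) ≠ ⊤ := measure_closedBall_lt_top.ne
    have hprob := cond_isProbabilityMeasure_of_finite h0 h1
    have hX : HasLaw (fun p : E n × Q.State => p.1)
        (volume.withDensity fun x =>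
          ENNReal.ofReal (uniformDensity (Metric.closedBall (0 : E n) τ) x))
        ((ProbabilityTheory.cond (volume : Measure (E n)) (Metric.closedBall 0 τ)).prod Q.law) := by
      rw [withDensity_uniformDensity hB h0 h1]
      exact ⟨measurable_fst.aemeasurable, by simp⟩
    have hS : HasLaw (fun p : E n × Q.State => p.2) Q.law
        ((ProbabilityTheory.cond (volume : Measure (E n)) (Metric.closedBall 0 τ)).prod Q.law) :=
      ⟨measurable_snd.aemeasurable, by simp⟩
    have hXS : IndepFun (fun p : E n × Q.State => p.1) (fun p : E n × Q.State => p.2)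
        ((ProbabilityTheory.cond (volume : Measure (E n)) (Metric.closedBall 0 τ)).prod Q.law) :=
      indepFun_prod measurable_id measurable_id
    obtain ⟨hh, hd⟩ := diffEntropy_uniformDensity hB h0 h1
    have hm := measurable_uniformDensity hB
    have hδ := deltaBar_uniformDensity_closedBall_le (n := n) hε hτ
    have hlow := hQ.le_condEntropy hℓ hm uniformDensity_nonneg hh hX hS hXS
    have hup := hQ.condEntropy_le hℓ hm uniformDensity_nonneg hB
      (fun x hx => Set.indicator_of_notMem hx _) hh hX hS hXS
      (ne_top_of_le_ne_top ENNReal.ofReal_ne_top hδ)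
    rw [hd] at hlow hup
    rw [log2_eq_logb h0 h1]
    have hr : 0 ≤ Real.logb 2 (Real.exp 1) * (((τ + ε) / τ) ^ n - 1) := by
      refine mul_nonneg logb_two_exp_one_pos.le (sub_nonneg.2 (one_le_pow₀ ?_))
      rw [one_le_div hτ]
      linarith
    have hup' := hup.trans (add_le_add_right (EReal.coe_ennreal_le_coe_ennreal_iff.2 hδ) _)
    rw [EReal.coe_ennreal_ofReal, max_eq_left hr, ← EReal.coe_add, ← EReal.coe_add] at hup'
    rw [← EReal.coe_add] at hlow
    generalize condEntropy (fun p : E n × Q.State => Q.toFun p.1 p.2) (fun p => p.2)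
        ((ProbabilityTheory.cond (volume : Measure (E n)) (Metric.closedBall 0 τ)).prod Q.law) = H
      at hlow hup'
    have hH : H ≠ ⊤ := by
      rintro rfl
      rw [EReal.coe_ennreal_top, top_le_iff] at hup'
      exact EReal.coe_ne_top _ hup'
    lift H to NNReal using hH
    rw [EReal.coe_nnreal_eq_coe_real, EReal.coe_le_coe_iff] at hlow hup'
    rw [EReal.coe_nnreal_eq_coe_real, ← EReal.coe_sub, EReal.coe_le_coe_iff,
      EReal.coe_le_coe_iff]
    simp only [Measure.real] at hlow hup'
    constructor <;> linarith
  refine Tendsto.limsup_eq ?_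
  refine tendsto_of_tendsto_of_tendsto_of_le_of_le' tendsto_const_nhds ?_
    ((eventually_gt_atTop 0).mono fun τ hτ => (hbound τ hτ).1)
    ((eventually_gt_atTop 0).mono fun τ hτ => (hbound τ hτ).2)
  refine (continuous_coe_real_ereal.tendsto l).comp ?_
  have h1 : Tendsto (fun τ : ℝ => (1 + ε / τ) ^ n) atTop (𝓝 ((1 + 0) ^ n)) :=
    ((tendsto_const_nhds.div_atTop tendsto_id).const_add 1).pow n
  have h2 : Tendsto (fun τ : ℝ => ((τ + ε) / τ) ^ n) atTop (𝓝 1) := by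
    rw [add_zero, one_pow] at h1
    refine h1.congr' ((eventually_gt_atTop 0).mono fun τ hτ => ?_)
    simp only
    rw [add_div, div_self hτ.ne']
  simpa using ((h2.sub_const 1).const_mul (Real.logb 2 (Real.exp 1))).const_add l

end

section

/-! ### Reduction modulo the lattice -/

variable {n : ℕ} {G : Matrix (Fin n) (Fin n) ℝ} {P A : Set (E n)}

theorem latticePoint_zero : latticePoint G 0 = 0 := by
  ext i
  simp [latticePoint, Matrix.mulVec, dotProduct]

theorem latticePoint_add (i j : Fin n → ℤ) :
    latticePoint G (i + j) = latticePoint G i + latticePoint G j := by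
  ext k
  simp [latticePoint, Matrix.mulVec, dotProduct, mul_add, Finset.sum_add_distrib]

/-- The lattice `G ℤⁿ` as an additive subgroup. -/
def lattice (G : Matrix (Fin n) (Fin n) ℝ) : AddSubgroup (E n) :=
  AddMonoidHom.range (AddMonoidHom.mk' (latticePoint G) latticePoint_add)

theorem latticePoint_mem (j : Fin n → ℤ) : latticePoint G j ∈ lattice G := ⟨j, rfl⟩

theorem exists_of_mem_lattice {g : E n} (hg : g ∈ lattice G) : ∃ j, g = latticePoint G j := by
  obtain ⟨j, rfl⟩ := hg
  exact ⟨j, rfl⟩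

instance countable_lattice : Countable (lattice G) :=
  Set.countable_range (latticePoint G)

/-- The representative of `v` modulo the lattice in the basic cell `P`. -/
def reduce (hP : IsBasicCell G P) (v : E n) : E n := v + latticeQuantizer hP (-v)

theorem reduce_mem (hP : IsBasicCell G P) (v : E n) : reduce hP v ∈ P := by
  have := (latticeIndex_eq_iff hP (-v) _).1 rfl
  rwa [sub_neg_eq_add, add_comm] at this

theorem reduce_eq_of_mem (hP : IsBasicCell G P) {v : E n} {j : Fin n → ℤ}
    (h : v + latticePoint G j ∈ P) : reduce hP v = v + latticePoint G j := by
  rw [reduce, latticeQuantizer, (latticeIndex_eq_iff hP (-v) j).2]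
  rwa [sub_neg_eq_add, add_comm]

theorem exists_reduce_eq (hP : IsBasicCell G P) (v : E n) :
    ∃ j, reduce hP v = v + latticePoint G j := ⟨latticeIndex hP (-v), rfl⟩

theorem reduce_add_latticePoint (hP : IsBasicCell G P) (v : E n) (j : Fin n → ℤ) :
    reduce hP (v + latticePoint G j) = reduce hP v := by
  obtain ⟨i, hi⟩ := exists_reduce_eq hP v
  have h : v + latticePoint G j + latticePoint G (-j + i) = reduce hP v := by
    rw [hi, latticePoint_add, latticePoint_neg]
    abel
  rw [reduce_eq_of_mem hP (h ▸ reduce_mem hP v), h]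

theorem reduce_of_mem (hP : IsBasicCell G P) {v : E n} (h : v ∈ P) : reduce hP v = v := by
  rw [reduce_eq_of_mem hP (j := 0), latticePoint_zero, add_zero]
  rwa [latticePoint_zero, add_zero]

theorem reduce_reduce_sub (hP : IsBasicCell G P) (v x : E n) :
    reduce hP (reduce hP v - x) = reduce hP (v - x) := by
  obtain ⟨j, hj⟩ := exists_reduce_eq hP v
  rw [hj, add_sub_right_comm, reduce_add_latticePoint]

theorem measurable_reduce (hP : IsBasicCell G P) : Measurable (reduce hP) :=
  measurable_id.add ((measurable_latticeQuantizer hP).comp measurable_neg)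

theorem isAddFundamentalDomain_of_existsUnique {D : Set (E n)} (hD : MeasurableSet D)
    (h : ∀ x : E n, ∃! j : Fin n → ℤ, x + latticePoint G j ∈ D) :
    IsAddFundamentalDomain (lattice G) D := by
  refine IsAddFundamentalDomain.mk' hD.nullMeasurableSet fun x => ?_
  obtain ⟨j, hj, huniq⟩ := h x
  refine ⟨⟨latticePoint G j, latticePoint_mem j⟩, ?_, ?_⟩
  · change latticePoint G j + x ∈ D
    rwa [add_comm]
  · rintro ⟨g, hg⟩ hgD
    obtain ⟨i, rfl⟩ := exists_of_mem_lattice hg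
    change latticePoint G i + x ∈ D at hgD
    rw [add_comm] at hgD
    exact Subtype.ext (congrArg (latticePoint G) (huniq i hgD))

theorem IsBasicCell.existsUnique_add (hP : IsBasicCell G P) (x : E n) :
    ∃! j : Fin n → ℤ, x + latticePoint G j ∈ P := by
  obtain ⟨j, hj, hu⟩ := hP.partition x
  refine ⟨-j, ?_, fun i hi => ?_⟩
  · simp only
    rwa [latticePoint_neg, ← sub_eq_add_neg]
  · rw [← hu (-i), neg_neg]
    simp only
    rwa [latticePoint_neg, sub_neg_eq_add]

theorem IsBasicCell.isAddFundamentalDomain (hP : IsBasicCell G P) :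
    IsAddFundamentalDomain (lattice G) P :=
  isAddFundamentalDomain_of_existsUnique hP.measurableSet hP.existsUnique_add

theorem IsBasicCell.isAddFundamentalDomain_sub_right (hP : IsBasicCell G P) (t : E n) :
    IsAddFundamentalDomain (lattice G) ((fun x => x - t) ⁻¹' P) := by
  refine isAddFundamentalDomain_of_existsUnique
    ((measurable_id.sub_const t) hP.measurableSet) fun x => ?_
  simpa only [Set.mem_preimage, add_sub_right_comm] using hP.existsUnique_add (x - t)

theorem IsBasicCell.isAddFundamentalDomain_sub_left (hP : IsBasicCell G P) (t : E n) :
    IsAddFundamentalDomain (lattice G) ((fun x => t - x) ⁻¹' P) := by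
  refine isAddFundamentalDomain_of_existsUnique
    ((measurable_const.sub measurable_id) hP.measurableSet) fun x => ?_
  have := (Equiv.neg _).bijective.existsUnique_iff.1 (hP.existsUnique_add (t - x))
  simpa only [Set.mem_preimage, sub_add_eq_sub_sub, sub_eq_add_neg (t - x), ← latticePoint_neg,
    Equiv.neg_apply] using this

/-- Integrals of lattice-periodic functions over fundamental domains agree. -/
theorem IsBasicCell.setLIntegral_eq (hP : IsBasicCell G P) {D : Set (E n)}
    (hD : IsAddFundamentalDomain (lattice G) D) {g : E n → ℝ≥0∞}
    (hg : ∀ x j, g (x + latticePoint G j) = g x) :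
    ∫⁻ x in P, g x = ∫⁻ x in D, g x := by
  refine hP.isAddFundamentalDomain.setLIntegral_eq hD g ?_
  rintro ⟨l, hl⟩ x
  obtain ⟨j, rfl⟩ := exists_of_mem_lattice hl
  change g (latticePoint G j + x) = g x
  rw [add_comm, hg]

/-! ### Stationarity of the dither sequence -/

/-- The uniform distribution on `P` is invariant under translations modulo the lattice. -/
theorem map_reduce_add_cond (hP : IsBasicCell G P) (t : E n) :
    (ProbabilityTheory.cond (volume : Measure (E n)) P).map (fun v => reduce hP (v + t)) =
      ProbabilityTheory.cond volume P := by
  have hm : Measurable fun v => reduce hP (v + t) :=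
    (measurable_reduce hP).comp (measurable_id.add_const t)
  ext B hB
  rw [Measure.map_apply hm hB, cond_apply hP.measurableSet, cond_apply hP.measurableSet]
  congr 1
  -- Being lattice-periodic, `g` has the same integral over the fundamental domains `P` and `P + t`;
  -- these integrals are the two volumes to be compared.
  set g : E n → ℝ≥0∞ := fun v => B.indicator 1 (reduce hP v) with hg
  have hgper : ∀ x j, g (x + latticePoint G j) = g x := fun x j => by
    simp only [hg, reduce_add_latticePoint]
  have h1 : ∫⁻ v in P, g v = volume (P ∩ B) := by
    rw [setLIntegral_congr_fun (g := B.indicator 1) hP.measurableSet fun v hv => by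
      simp only [hg, reduce_of_mem hP hv], setLIntegral_indicator hB, Set.inter_comm]
    simp
  have h2 : ∫⁻ v in (fun x => x - t) ⁻¹' P, g v =
      volume (P ∩ (fun v => reduce hP (v + t)) ⁻¹' B) := by
    have hmp : MeasurePreserving (fun v : E n => v + t) := measurePreserving_add_right volume t
    have hgm : Measurable g := (measurable_one.indicator hB).comp (measurable_reduce hP)
    have hD : MeasurableSet ((fun x : E n => x - t) ⁻¹' P) :=
      (measurable_id.sub_const t) hP.measurableSet
    rw [← hmp.setLIntegral_comp_preimage hD hgm]
    have : (fun v : E n => v + t) ⁻¹' ((fun x => x - t) ⁻¹' P) = P := by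
      ext x
      simp
    rw [this]
    have : (fun v => g (v + t)) = ((fun v => reduce hP (v + t)) ⁻¹' B).indicator 1 := by
      ext v
      rfl
    rw [this, setLIntegral_indicator (hm hB), Set.inter_comm]
    simp
  rw [← h1, ← h2, hP.setLIntegral_eq (hP.isAddFundamentalDomain_sub_right t) hgper]

/-- The distribution of the dither sequence. -/
abbrev ditherLaw (P : Set (E n)) : Measure (ℕ → E n) :=
  Measure.infinitePi fun _ : ℕ => ProbabilityTheory.cond (volume : Measure (E n)) P

/-- Shifting every dither by `-x` and reducing modulo the lattice preserves the i.i.d. uniform law,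
and by `hadd` and `hred` this change of variables turns `ψ 0` into `ψ x`. -/
theorem lintegral_ditherLaw_stationary (hP : IsBasicCell G P) {ψ : E n → (ℕ → E n) → ℝ≥0∞}
    (hm : Measurable (ψ 0)) (hadd : ∀ x t v, ψ (x + t) (fun i => v i + t) = ψ x v)
    (hred : ∀ x v, ψ x (fun i => reduce hP (v i)) = ψ x v) (x : E n) :
    ∫⁻ v, ψ x v ∂(ditherLaw P) = ∫⁻ v, ψ 0 v ∂(ditherLaw P) := by
  have := hP.isProbabilityMeasure
  have hr : Measurable fun v => reduce hP (v + -x) :=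
    (measurable_reduce hP).comp (measurable_id.add_const _)
  have hr' : Measurable fun (v : ℕ → E n) i => reduce hP (v i + -x) :=
    measurable_pi_lambda _ fun i => hr.comp (measurable_pi_apply i)
  have hmap : (ditherLaw P).map (fun v i => reduce hP (v i + -x)) = ditherLaw P := by
    rw [ditherLaw, Measure.infinitePi_map_pi _ fun _ => hr]
    simp_rw [map_reduce_add_cond hP]
  conv_rhs => rw [← hmap]
  rw [lintegral_map hm hr']
  refine lintegral_congr fun v => ?_
  rw [hred 0 fun i => v i + -x, ← hadd 0 x]
  simp

end

section

variable {n : ℕ} {G : Matrix (Fin n) (Fin n) ℝ} {P A : Set (E n)}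

/-! ### Equivariance of the rejection-sampled quantizer -/

/-- The quantization error is the representative in `P` of `v - x`, so acceptance depends only on
the dithers minus `x` modulo the lattice. All the equivariance below follows from this. -/
theorem latticeQuantizer_sub_add (hP : IsBasicCell G P) (x v : E n) :
    latticeQuantizer hP (x - v) + v = x + reduce hP (v - x) := by
  rw [reduce, neg_sub]
  abel

theorem acceptIndex_eq (hP : IsBasicCell G P) (A : Set (E n)) (x : E n) (v : ℕ → E n) :
    acceptIndex hP A x v = sInf {i | reduce hP (v i - x) ∈ A} := by
  simp only [acceptIndex, latticeQuantizer_sub_add, add_sub_cancel_left]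

theorem rsuqFun_eq (hP : IsBasicCell G P) (A : Set (E n)) (x : E n) (v : ℕ → E n) :
    rsuqFun hP A x v = x + reduce hP (v (acceptIndex hP A x v) - x) := by
  rw [rsuqFun, latticeQuantizer_sub_add]

theorem acceptIndex_add (hP : IsBasicCell G P) (A : Set (E n)) (x t : E n) (v : ℕ → E n) :
    acceptIndex hP A (x + t) (fun i => v i + t) = acceptIndex hP A x v := by
  simp only [acceptIndex_eq, add_sub_add_right_eq_sub]

theorem rsuqFun_add (hP : IsBasicCell G P) (A : Set (E n)) (x t : E n) (v : ℕ → E n) :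
    rsuqFun hP A (x + t) (fun i => v i + t) = rsuqFun hP A x v + t := by
  simp only [rsuqFun_eq, acceptIndex_add, add_sub_add_right_eq_sub]
  abel

theorem acceptIndex_reduce (hP : IsBasicCell G P) (A : Set (E n)) (x : E n) (v : ℕ → E n) :
    acceptIndex hP A x (fun i => reduce hP (v i)) = acceptIndex hP A x v := by
  simp only [acceptIndex_eq, reduce_reduce_sub]

theorem rsuqFun_reduce (hP : IsBasicCell G P) (A : Set (E n)) (x : E n) (v : ℕ → E n) :
    rsuqFun hP A x (fun i => reduce hP (v i)) = rsuqFun hP A x v := by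
  simp only [rsuqFun_eq, acceptIndex_reduce, reduce_reduce_sub]

theorem reduce_sub_add_latticePoint (hP : IsBasicCell G P) (v x : E n) (j : Fin n → ℤ) :
    reduce hP (v - (x + latticePoint G j)) = reduce hP (v - x) := by
  rw [sub_add_eq_sub_sub, sub_eq_add_neg (v - x), ← latticePoint_neg, reduce_add_latticePoint]

theorem acceptIndex_add_latticePoint (hP : IsBasicCell G P) (A : Set (E n)) (x : E n)
    (j : Fin n → ℤ) (v : ℕ → E n) :
    acceptIndex hP A (x + latticePoint G j) v = acceptIndex hP A x v := by
  simp only [acceptIndex_eq, reduce_sub_add_latticePoint]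

theorem rsuqFun_add_latticePoint (hP : IsBasicCell G P) (A : Set (E n)) (x : E n)
    (j : Fin n → ℤ) (v : ℕ → E n) :
    rsuqFun hP A (x + latticePoint G j) v = rsuqFun hP A x v + latticePoint G j := by
  simp only [rsuqFun_eq, acceptIndex_add_latticePoint, reduce_sub_add_latticePoint]
  abel

/-- The volume of the quantization cell of `x`. -/
def cellVolume (hP : IsBasicCell G P) (A : Set (E n)) (x : E n) (v : ℕ → E n) : ℝ≥0∞ :=
  volume ((fun x' => rsuqFun hP A x' v) ⁻¹' {rsuqFun hP A x v})

theorem measurable_cellVolume (hP : IsBasicCell G P) (hA : MeasurableSet A) :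
    Measurable (Function.uncurry (cellVolume hP A)) :=
  (rsuq hP hA).measurable_cellMass volume

theorem cellVolume_eq_of_forall (hP : IsBasicCell G P) (A : Set (E n)) {x y t : E n}
    {v w : ℕ → E n} (h : ∀ x', rsuqFun hP A (x' + t) w = rsuqFun hP A x' v + t)
    (hy : y = x + t) : cellVolume hP A y w = cellVolume hP A x v := by
  rw [cellVolume, cellVolume, hy, ← measure_preimage_add_right volume t]
  congr 1
  ext x'
  simp [h]

theorem cellVolume_add (hP : IsBasicCell G P) (A : Set (E n)) (x t : E n) (v : ℕ → E n) :
    cellVolume hP A (x + t) (fun i => v i + t) = cellVolume hP A x v :=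
  cellVolume_eq_of_forall hP A (fun x' => rsuqFun_add hP A x' t v) rfl

theorem cellVolume_add_latticePoint (hP : IsBasicCell G P) (A : Set (E n)) (x : E n)
    (j : Fin n → ℤ) (v : ℕ → E n) :
    cellVolume hP A (x + latticePoint G j) v = cellVolume hP A x v :=
  cellVolume_eq_of_forall hP A (fun x' => rsuqFun_add_latticePoint hP A x' j v) rfl

theorem cellVolume_reduce (hP : IsBasicCell G P) (A : Set (E n)) (x : E n) (v : ℕ → E n) :
    cellVolume hP A x (fun i => reduce hP (v i)) = cellVolume hP A x v := by
  simp only [cellVolume, rsuqFun_reduce]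

/-! ### Acceptance -/

/-- The probability of accepting a dither. -/
abbrev acceptProb (P A : Set (E n)) : ℝ≥0∞ := ProbabilityTheory.cond volume P A

theorem acceptProb_eq (hP : IsBasicCell G P) (hAP : A ⊆ P) :
    acceptProb P A = (volume P)⁻¹ * volume A := by
  rw [acceptProb, cond_apply hP.measurableSet, Set.inter_eq_right.2 hAP]

theorem IsBasicCell.volume_ne_top (hP : IsBasicCell G P) : volume P ≠ ⊤ :=
  hP.bounded.measure_lt_top.ne

theorem acceptProb_ne_zero (hP : IsBasicCell G P) (hAP : A ⊆ P) (hA0 : volume A ≠ 0) :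
    acceptProb P A ≠ 0 := by
  rw [acceptProb_eq hP hAP]
  exact mul_ne_zero (ENNReal.inv_ne_zero.2 hP.volume_ne_top) hA0

theorem acceptProb_le_one (hP : IsBasicCell G P) : acceptProb P A ≤ 1 :=
  haveI := hP.isProbabilityMeasure
  prob_le_one

/-- At input `0` the reduction acts trivially on dithers in `P`, so the rejections are independent
events of probability `1 - acceptProb P A`. -/
theorem measure_rejected_le (hP : IsBasicCell G P) (hA : MeasurableSet A) (m : ℕ) :
    ditherLaw P {v | ∀ i < m, reduce hP (v i - 0) ∉ A} ≤ (1 - acceptProb P A) ^ m := by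
  have := hP.isProbabilityMeasure
  have hset : {v : ℕ → E n | ∀ i < m, reduce hP (v i - 0) ∉ A} =
      (↑(Finset.range m) : Set ℕ).pi fun _ => reduce hP ⁻¹' Aᶜ := by
    ext v
    simp [Set.mem_pi]
  rw [hset, Measure.infinitePi_pi _ fun i _ => measurable_reduce hP hA.compl]
  have hae : (reduce hP ⁻¹' Aᶜ : Set (E n)) =ᵐ[ProbabilityTheory.cond volume P] (Aᶜ : Set (E n)) := by
    filter_upwards [ae_cond_mem hP.measurableSet] with v hv
    refine propext ?_
    change reduce hP v ∈ Aᶜ ↔ v ∈ Aᶜ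
    rw [reduce_of_mem hP hv]
  rw [Finset.prod_const, Finset.card_range, measure_congr hae, prob_compl_eq_one_sub hA]

theorem measurable_acceptIndex_zero (hP : IsBasicCell G P) (hA : MeasurableSet A) :
    Measurable (acceptIndex hP A 0) :=
  (measurable_acceptIndex hP hA).of_uncurry_left

/-- Tail-sum formula with geometric tails. Indices start at `0`, so an index above `m` means that at
least `m + 1` dithers were rejected; the default value `0` of `sInf ∅` never enters the tails. -/
theorem lintegral_acceptIndex_le (hP : IsBasicCell G P) (hA : MeasurableSet A) :
    ∫⁻ v, (acceptIndex hP A 0 v : ℝ≥0∞) ∂(ditherLaw P) ≤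
      (1 - acceptProb P A) / acceptProb P A := by
  set r := 1 - acceptProb P A with hr
  have hm := measurable_acceptIndex_zero hP hA
  have hms : ∀ m : ℕ, MeasurableSet {v : ℕ → E n | m < acceptIndex hP A 0 v} := fun m =>
    hm measurableSet_Ioi
  have hsum : ∀ v : ℕ → E n, (acceptIndex hP A 0 v : ℝ≥0∞) =
      ∑' m : ℕ, {v : ℕ → E n | m < acceptIndex hP A 0 v}.indicator 1 v := by
    intro v
    rw [tsum_eq_sum (s := Finset.range (acceptIndex hP A 0 v))]
    · rw [Finset.sum_congr rfl (g := fun _ => 1)]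
      · simp
      · intro m hm
        exact Set.indicator_of_mem (s := {v : ℕ → E n | m < acceptIndex hP A 0 v})
          (Finset.mem_range.1 hm) 1
    · intro m hm
      exact Set.indicator_of_notMem (s := {v : ℕ → E n | m < acceptIndex hP A 0 v})
        (fun h => hm (Finset.mem_range.2 h)) 1
  have hle : ∀ m : ℕ, ditherLaw P {v : ℕ → E n | m < acceptIndex hP A 0 v} ≤ r ^ (m + 1) := by
    intro m
    refine (measure_mono fun v hv i hi => ?_).trans (measure_rejected_le hP hA (m + 1))
    have hv' : i < acceptIndex hP A 0 v := (Nat.lt_succ_iff.1 hi).trans_lt hv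
    rw [acceptIndex_eq] at hv'
    exact Nat.notMem_of_lt_sInf hv'
  calc ∫⁻ v, (acceptIndex hP A 0 v : ℝ≥0∞) ∂(ditherLaw P)
      = ∑' m : ℕ, ditherLaw P {v : ℕ → E n | m < acceptIndex hP A 0 v} := by
        simp_rw [hsum]
        rw [lintegral_tsum fun m => (measurable_one.indicator (hms m)).aemeasurable]
        exact tsum_congr fun m => lintegral_indicator_one (hms m)
    _ ≤ ∑' m : ℕ, r ^ (m + 1) := ENNReal.tsum_le_tsum hle
    _ = r / acceptProb P A := by
        simp_rw [pow_succ']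
        rw [ENNReal.tsum_mul_left, ENNReal.tsum_geometric, hr,
          ENNReal.sub_sub_cancel ENNReal.one_ne_top (acceptProb_le_one hP), div_eq_mul_inv]

/-- For every `x`, some dither is almost surely accepted. -/
theorem ae_exists_accepted (hP : IsBasicCell G P) (hA : MeasurableSet A) (hAP : A ⊆ P)
    (hA0 : volume A ≠ 0) (x : E n) :
    ∀ᵐ v ∂(ditherLaw P), ∃ i, reduce hP (v i - x) ∈ A := by
  have := hP.isProbabilityMeasure
  have hms : ∀ x : E n, MeasurableSet {v : ℕ → E n | ∀ i, reduce hP (v i - x) ∉ A} := by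
    intro x
    rw [Set.ofPred_forall]
    refine MeasurableSet.iInter fun i => ?_
    have : Measurable fun v : ℕ → E n => reduce hP (v i - x) :=
      (measurable_reduce hP).comp ((measurable_pi_apply i).sub measurable_const)
    exact this hA.compl
  have h0 : ditherLaw P {v : ℕ → E n | ∀ i, reduce hP (v i - 0) ∉ A} = 0 := by
    have hr : 1 - acceptProb P A < 1 :=
      ENNReal.sub_lt_self ENNReal.one_ne_top one_ne_zero (acceptProb_ne_zero hP hAP hA0)
    refine le_antisymm (ge_of_tendsto' (ENNReal.tendsto_pow_atTop_nhds_zero_of_lt_one hr)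
      fun m => ?_) zero_le
    have hsub : {v : ℕ → E n | ∀ i, reduce hP (v i - 0) ∉ A} ⊆
        {v | ∀ i < m, reduce hP (v i - 0) ∉ A} := fun v hv i _ => hv i
    exact (measure_mono hsub).trans (measure_rejected_le hP hA m)
  -- The case `x = 0` transfers to every `x` by stationarity of the event that all dithers are
  -- rejected.
  have hst := lintegral_ditherLaw_stationary hP
    (ψ := fun x v => {v : ℕ → E n | ∀ i, reduce hP (v i - x) ∉ A}.indicator 1 v)
    (measurable_one.indicator (hms 0))
    (fun x t v => Set.indicator_eq_indicator
      (forall_congr' fun i => by rw [add_sub_add_right_eq_sub]) rfl)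
    (fun x v => Set.indicator_eq_indicator
      (forall_congr' fun i => by rw [reduce_reduce_sub]) rfl) x
  rw [lintegral_indicator_one (hms x), lintegral_indicator_one (hms 0), h0] at hst
  rw [ae_iff]
  simpa using hst

theorem ae_ae_exists_accepted (hP : IsBasicCell G P) (hA : MeasurableSet A) (hAP : A ⊆ P)
    (hA0 : volume A ≠ 0) :
    ∀ᵐ v ∂(ditherLaw P), ∀ᵐ x, ∃ i, reduce hP (v i - x) ∈ A := by
  have := hP.isProbabilityMeasure
  refine (Measure.ae_ae_comm (p := fun (x : E n) (v : ℕ → E n) =>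
    ∃ i, reduce hP (v i - x) ∈ A) ?_).1
    (Eventually.of_forall (ae_exists_accepted hP hA hAP hA0))
  rw [Set.ofPred_exists]
  refine MeasurableSet.iUnion fun i => ?_
  have : Measurable fun p : E n × (ℕ → E n) => reduce hP (p.2 i - p.1) :=
    (measurable_reduce hP).comp (((measurable_pi_apply i).comp measurable_snd).sub measurable_fst)
  exact this hA

/-! ### Volume and diameter of the cells -/

theorem rsuqFun_sub_mem (hP : IsBasicCell G P) {x : E n} {v : ℕ → E n}
    (h : ∃ i, reduce hP (v i - x) ∈ A) : rsuqFun hP A x v - x ∈ A := by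
  rw [rsuqFun_eq, add_sub_cancel_left, acceptIndex_eq]
  exact Nat.sInf_mem (s := {i | reduce hP (v i - x) ∈ A}) h

/-- The cell with value `y` is contained in `y - A` up to the null set of inputs for which no dither
is accepted. -/
theorem ae_cellVolume_le (hP : IsBasicCell G P) (hA : MeasurableSet A) (hAP : A ⊆ P)
    (hA0 : volume A ≠ 0) : ∀ᵐ v ∂(ditherLaw P), ∀ x, cellVolume hP A x v ≤ volume A := by
  filter_upwards [ae_ae_exists_accepted hP hA hAP hA0] with v hv x
  rw [cellVolume]
  calc _ ≤ volume ((fun x' => rsuqFun hP A x v - x') ⁻¹' A) := by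
        refine measure_mono_ae ?_
        filter_upwards [hv] with x' hx' hmem
        change rsuqFun hP A x v - x' ∈ A
        rw [← Set.mem_singleton_iff.1 hmem]
        exact rsuqFun_sub_mem hP hx'
    _ = volume A := (Measure.measurePreserving_sub_left volume _).measure_preimage hA.nullMeasurableSet

theorem ae_norm_sub_le_diam (hP : IsBasicCell G P) (hA : MeasurableSet A) (hAP : A ⊆ P)
    (hA0 : volume A ≠ 0) : ∀ᵐ v ∂(ditherLaw P), ∀ᵐ x, ∀ᵐ x',
      rsuqFun hP A x' v = rsuqFun hP A x v → ‖x - x'‖ ≤ Metric.diam A := by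
  filter_upwards [ae_ae_exists_accepted hP hA hAP hA0] with v hv
  filter_upwards [hv] with x hx
  filter_upwards [hv] with x' hx' heq
  have h1 := rsuqFun_sub_mem hP hx
  have h2 := rsuqFun_sub_mem hP hx'
  rw [heq] at h2
  have := Metric.dist_le_diam_of_mem (hP.bounded.subset hAP) h2 h1
  rwa [dist_eq_norm, sub_sub_sub_cancel_left] at this

/-! ### The mean log-volume of a cell -/

/-- There is at most one cell accepted in round `i` per volume of `P`. -/
theorem lintegral_inv_cellVolume_le (hP : IsBasicCell G P) (hA : MeasurableSet A) (i : ℕ) :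
    ∫⁻ v, {v : ℕ → E n | acceptIndex hP A 0 v = i}.indicator
      (fun v => (cellVolume hP A 0 v)⁻¹) v ∂(ditherLaw P) ≤ (volume P)⁻¹ := by
  have := hP.isProbabilityMeasure
  set φ : E n → (ℕ → E n) → ℝ≥0∞ := fun x v =>
    {v : ℕ → E n | acceptIndex hP A x v = i}.indicator (fun v => (cellVolume hP A x v)⁻¹) v
    with hφ
  have hφm : Measurable (Function.uncurry φ) :=
    (measurable_cellVolume hP hA).inv.indicator
      ((measurable_acceptIndex hP hA) (measurableSet_singleton i))
  have hst : ∀ x, ∫⁻ v, φ x v ∂(ditherLaw P) = ∫⁻ v, φ 0 v ∂(ditherLaw P) :=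
    lintegral_ditherLaw_stationary hP hφm.of_uncurry_left
      (fun x t v => by simp only [hφ, Set.indicator, Set.mem_ofPred_eq, acceptIndex_add,
        cellVolume_add])
      (fun x v => by simp only [hφ, Set.indicator, Set.mem_ofPred_eq, acceptIndex_reduce,
        cellVolume_reduce])
  have hcell : ∀ v, ∫⁻ x in P, φ x v ≤ 1 := by
    intro v
    have hper : ∀ x j, φ (x + latticePoint G j) v = φ x v := fun x j => by
      simp only [hφ, Set.indicator, Set.mem_ofPred_eq, acceptIndex_add_latticePoint,
        cellVolume_add_latticePoint]
    -- On the fundamental domain `v i - P` the reduction of `v i - x` is trivial, so every input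
    -- with index `i` has output exactly `v i`: they all share one cell, whose inverse volume
    -- integrates to at most 1.
    rw [hP.setLIntegral_eq (hP.isAddFundamentalDomain_sub_left (v i)) hper]
    set C := (fun x' => rsuqFun hP A x' v) ⁻¹' {v i} with hC
    have hCm : MeasurableSet C := (rsuq hP hA).measurable_section v (measurableSet_singleton _)
    calc ∫⁻ x in (fun x => v i - x) ⁻¹' P, φ x v
        ≤ ∫⁻ x in (fun x => v i - x) ⁻¹' P, C.indicator (fun _ => (volume C)⁻¹) x := by
          refine setLIntegral_mono (measurable_const.indicator hCm) fun x hx => ?_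
          by_cases hi : acceptIndex hP A x v = i
          · have hQ : rsuqFun hP A x v = v i := by
              rw [rsuqFun_eq, hi, reduce_of_mem hP hx, add_sub_cancel]
            have hxC : x ∈ C := hQ
            rw [Set.indicator_of_mem hxC]
            simp only [hφ, Set.indicator, Set.mem_ofPred_eq, hi, if_true, cellVolume, hQ, hC]
            exact le_rfl
          · simp only [hφ, Set.indicator, Set.mem_ofPred_eq, hi, if_false]
            exact zero_le
      _ ≤ ∫⁻ x, C.indicator (fun _ => (volume C)⁻¹) x := setLIntegral_le_lintegral _ _
      _ = (volume C)⁻¹ * volume C := lintegral_indicator_const hCm _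
      _ ≤ 1 := ENNReal.inv_mul_le_one _
  -- By stationarity the input `0` can be replaced by an average over `P`; Tonelli then reduces to a
  -- fixed dither sequence.
  have hmul : volume P * ∫⁻ v, φ 0 v ∂(ditherLaw P) ≤ 1 := by
    calc volume P * ∫⁻ v, φ 0 v ∂(ditherLaw P)
        = ∫⁻ x in P, ∫⁻ v, φ x v ∂(ditherLaw P) := by
          simp_rw [hst]
          rw [setLIntegral_const, mul_comm]
      _ = ∫⁻ v, (∫⁻ x in P, φ x v) ∂(ditherLaw P) :=
          lintegral_lintegral_swap hφm.aemeasurable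
      _ ≤ ∫⁻ _, 1 ∂(ditherLaw P) := lintegral_mono hcell
      _ = 1 := by simp
  rw [← one_div, ENNReal.le_div_iff_mul_le (Or.inl hP.volume_ne_zero) (Or.inl hP.volume_ne_top),
    mul_comm]
  exact hmul

/-- With `r = 1 - p`, write `log (a / M) = log (r ^ k a / M) + k log (1 / r)` and apply `log u ≤ (u
- 1) log e` to both, noting `1 / r - 1 = p / (1 - p)`. The weight `r ^ k` is chosen so that both
terms on the right have mean at most 1. -/
theorem ofReal_logb_add_le {a M p : ℝ≥0∞} (ha0 : a ≠ 0) (ha : a ≠ ⊤) (hMa : M ≤ a) (hp0 : p ≠ 0)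
    (hp1 : p ≤ 1) (k : ℕ) :
    ENNReal.ofReal (Real.logb 2 (a.toReal / M.toReal)) + ENNReal.ofReal (Real.logb 2 (Real.exp 1)) ≤
      ENNReal.ofReal (Real.logb 2 (Real.exp 1)) *
        ((1 - p) ^ k * a * M⁻¹ + k * (p / (1 - p))) := by
  have hκ := logb_two_exp_one_pos
  have hκ0 : ENNReal.ofReal (Real.logb 2 (Real.exp 1)) ≠ 0 := by simpa using hκ
  -- For `p = 1` the right side is infinite unless `k = 0`, where `0 * ⊤ = 0` leaves the plain
  -- logarithm inequality.
  rcases eq_or_ne (1 - p) 0 with hr | hr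
  · rcases Nat.eq_zero_or_pos k with rfl | hk
    · rcases eq_or_ne M 0 with rfl | hM
      · simp [ENNReal.mul_top, ha0, hκ0]
      have hMt := ne_top_of_le_ne_top ha hMa
      have hMp := ENNReal.toReal_pos hM hMt
      have hap := ENNReal.toReal_pos ha0 ha
      have h1 : 0 ≤ Real.logb 2 (a.toReal / M.toReal) :=
        Real.logb_nonneg one_lt_two ((one_le_div hMp).2 (ENNReal.toReal_mono ha hMa))
      have h2 := logb_two_le_mul_sub_one (t := a.toReal / M.toReal) (by positivity)
      rw [← ENNReal.ofReal_add h1 hκ.le, pow_zero, one_mul, Nat.cast_zero, zero_mul, add_zero,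
        ← div_eq_mul_inv, ← ENNReal.ofReal_toReal (ENNReal.div_ne_top ha hM), ENNReal.toReal_div,
        ← ENNReal.ofReal_mul hκ.le]
      exact ENNReal.ofReal_le_ofReal (by linarith)
    · rw [hr, ENNReal.div_zero hp0, ENNReal.mul_top (by exact_mod_cast hk.ne'), add_top,
        ENNReal.mul_top hκ0]
      exact le_top
  · rcases eq_or_ne M 0 with rfl | hM
    · rw [ENNReal.inv_zero, ENNReal.mul_top (mul_ne_zero (pow_ne_zero _ hr) ha0), top_add,
        ENNReal.mul_top hκ0]
      exact le_top
    have hMt := ne_top_of_le_ne_top ha hMa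
    have hpt := ne_top_of_le_ne_top ENNReal.one_ne_top hp1
    have hrt : 1 - p ≠ ⊤ := ENNReal.sub_ne_top ENNReal.one_ne_top
    have hMp := ENNReal.toReal_pos hM hMt
    have hap := ENNReal.toReal_pos ha0 ha
    have hrp := ENNReal.toReal_pos hr hrt
    have hpr : p.toReal = 1 - (1 - p).toReal := by
      rw [ENNReal.toReal_sub_of_le hp1 ENNReal.one_ne_top, ENNReal.toReal_one]
      ring
    have h1 : 0 ≤ Real.logb 2 (a.toReal / M.toReal) :=
      Real.logb_nonneg one_lt_two ((one_le_div hMp).2 (ENNReal.toReal_mono ha hMa))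
    have hfin : (1 - p) ^ k * a * M⁻¹ + k * (p / (1 - p)) ≠ ⊤ :=
      ENNReal.add_ne_top.2 ⟨ENNReal.mul_ne_top (ENNReal.mul_ne_top (ENNReal.pow_ne_top hrt) ha)
        (ENNReal.inv_ne_top.2 hM), ENNReal.mul_ne_top (ENNReal.natCast_ne_top k)
        (ENNReal.div_ne_top hpt hr)⟩
    rw [← ENNReal.ofReal_add h1 hκ.le, ← ENNReal.ofReal_toReal hfin, ← ENNReal.ofReal_mul hκ.le]
    refine ENNReal.ofReal_le_ofReal ?_
    rw [ENNReal.toReal_add (ne_top_of_le_ne_top hfin le_self_add)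
      (ne_top_of_le_ne_top hfin le_add_self)]
    simp only [ENNReal.toReal_mul, ENNReal.toReal_pow, ENNReal.toReal_inv, ENNReal.toReal_natCast,
      ENNReal.toReal_div]
    rw [hpr]
    set r := (1 - p).toReal
    set t := a.toReal / M.toReal with ht
    have htp : 0 < t := by positivity
    have h2 := logb_two_le_mul_sub_one (t := r ^ k * t) (by positivity)
    have h3 := logb_two_le_mul_sub_one (t := r⁻¹) (by positivity)
    rw [Real.logb_mul (by positivity) htp.ne', Real.logb_pow] at h2
    rw [Real.logb_inv] at h3
    have h4 := mul_le_mul_of_nonneg_left h3 (Nat.cast_nonneg (α := ℝ) k)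
    have h5 : (1 - r) / r = r⁻¹ - 1 := by field_simp
    have h6 : r ^ k * a.toReal * M.toReal⁻¹ = r ^ k * t := by rw [ht]; ring
    rw [h5, h6]
    linarith

theorem lintegral_logb_cellVolume_le (hP : IsBasicCell G P) (hA : MeasurableSet A) (hAP : A ⊆ P)
    (hA0 : volume A ≠ 0) :
    ∫⁻ v, ENNReal.ofReal (Real.logb 2 ((volume A).toReal / (cellVolume hP A 0 v).toReal))
      ∂(ditherLaw P) ≤ ENNReal.ofReal (Real.logb 2 (Real.exp 1)) := by
  have := hP.isProbabilityMeasure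
  have hAt : volume A ≠ ⊤ := measure_ne_top_of_subset hAP hP.volume_ne_top
  set κ := ENNReal.ofReal (Real.logb 2 (Real.exp 1)) with hκ
  have hκt : κ ≠ ⊤ := ENNReal.ofReal_ne_top
  set p := acceptProb P A with hp
  have hp0 : p ≠ 0 := acceptProb_ne_zero hP hAP hA0
  have hp1 : p ≤ 1 := acceptProb_le_one hP
  have hpt : p ≠ ⊤ := ne_top_of_le_ne_top ENNReal.one_ne_top hp1
  have hKm := measurable_acceptIndex_zero hP hA
  have hMm : Measurable fun v : ℕ → E n => cellVolume hP A 0 v :=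
    (measurable_cellVolume hP hA).of_uncurry_left
  have hKm' : Measurable fun v : ℕ → E n => (acceptIndex hP A 0 v : ℝ≥0∞) :=
    (Measurable.of_discrete (f := fun k : ℕ => (k : ℝ≥0∞))).comp hKm
  have h1 : ∫⁻ v, (1 - p) ^ acceptIndex hP A 0 v * volume A * (cellVolume hP A 0 v)⁻¹
      ∂(ditherLaw P) ≤ 1 := by
    have hsum : ∀ v, (1 - p) ^ acceptIndex hP A 0 v * volume A * (cellVolume hP A 0 v)⁻¹ =
        ∑' i : ℕ, (1 - p) ^ i * volume A * {v : ℕ → E n | acceptIndex hP A 0 v = i}.indicator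
          (fun v => (cellVolume hP A 0 v)⁻¹) v := by
      intro v
      rw [tsum_eq_single (acceptIndex hP A 0 v)]
      · simp [Set.indicator]
      · intro i hi
        simp [Set.indicator, hi.symm]
    have hm : ∀ i : ℕ, Measurable fun v => {v : ℕ → E n | acceptIndex hP A 0 v = i}.indicator
          (fun v => (cellVolume hP A 0 v)⁻¹) v := fun i =>
      hMm.inv.indicator (hKm (measurableSet_singleton i))
    calc _ = ∑' i : ℕ, (1 - p) ^ i * volume A * ∫⁻ v, {v : ℕ → E n |
            acceptIndex hP A 0 v = i}.indicator (fun v => (cellVolume hP A 0 v)⁻¹) v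
              ∂(ditherLaw P) := by
          simp_rw [hsum]
          rw [lintegral_tsum fun i => ((hm i).const_mul _).aemeasurable]
          exact tsum_congr fun i => lintegral_const_mul _ (hm i)
      -- Since `A ⊆ P`, the factor `μ(A) / μ(P)` is exactly `p`, and the geometric series sums to 1.
      _ ≤ ∑' i : ℕ, (1 - p) ^ i * p := by
          refine ENNReal.tsum_le_tsum fun i => ?_
          refine (mul_le_mul_right (lintegral_inv_cellVolume_le hP hA i) _).trans (le_of_eq ?_)
          rw [hp, acceptProb_eq hP hAP]
          ring
      _ = 1 := by
          rw [ENNReal.tsum_mul_right, ENNReal.tsum_geometric,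
            ENNReal.sub_sub_cancel ENNReal.one_ne_top hp1, ENNReal.inv_mul_cancel hp0 hpt]
  have h2 : ∫⁻ v, (acceptIndex hP A 0 v : ℝ≥0∞) * (p / (1 - p)) ∂(ditherLaw P) ≤ 1 := by
    rw [lintegral_mul_const _ hKm']
    refine (mul_le_mul_left (lintegral_acceptIndex_le hP hA) _).trans ?_
    -- Only `≤ 1` is available for the product: at `p = 1` it is `0 * ⊤ = 0`.
    rw [← hp, ENNReal.div_eq_inv_mul, ENNReal.div_eq_inv_mul]
    calc p⁻¹ * (1 - p) * ((1 - p)⁻¹ * p) = (p⁻¹ * p) * ((1 - p)⁻¹ * (1 - p)) := by ring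
      _ ≤ 1 := mul_le_one' (ENNReal.inv_mul_le_one _) (ENNReal.inv_mul_le_one _)
  have hpoint := lintegral_mono_ae <| (ae_cellVolume_le hP hA hAP hA0).mono fun v hv =>
    ofReal_logb_add_le hA0 hAt (hv 0) hp0 hp1 (acceptIndex hP A 0 v)
  rw [lintegral_add_right _ measurable_const, lintegral_const_mul' _ _ hκt,
    lintegral_add_right _ (hKm'.mul_const _)] at hpoint
  have h3 := hpoint.trans (mul_le_mul_right (add_le_add h1 h2) κ)
  rw [lintegral_const, measure_univ, mul_one, mul_add, mul_one] at h3
  exact (ENNReal.add_le_add_iff_right hκt).1 h3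

theorem stationaryCells_rsuq (hP : IsBasicCell G P) (hA : MeasurableSet A) (hAP : A ⊆ P)
    (hA0 : volume A ≠ 0) :
    StationaryCells (rsuq hP hA) (Metric.diam A) (volume A)
      (∫⁻ v, ENNReal.ofReal (Real.logb 2 ((volume A).toReal / (cellVolume hP A 0 v).toReal))
        ∂(ditherLaw P)) where
  a_ne_zero := hA0
  a_ne_top := measure_ne_top_of_subset hAP hP.volume_ne_top
  volume_le := ae_cellVolume_le hP hA hAP hA0
  diam_le := ae_norm_sub_le_diam hP hA hAP hA0
  lintegral_logb := lintegral_ditherLaw_stationary hP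
    (ψ := fun x v => ENNReal.ofReal
      (Real.logb 2 ((volume A).toReal / (cellVolume hP A x v).toReal)))
    (measurable_const.div (measurable_cellVolume hP hA).of_uncurry_left.ennreal_toReal
      ).real_logb.ennreal_ofReal
    (fun x t v => by simp only [cellVolume_add])
    (fun x v => by simp only [cellVolume_reduce])

end

end RSUQ

end

/-! ### The entropy bounds for the rejection-sampled quantizer -/

theorem mainTheorem7 {n : ℕ} (G : Matrix (Fin n) (Fin n) ℝ) (hG : G.det ≠ 0)
    (P : Set (RSUQ.E n)) (hP : RSUQ.IsBasicCell G P)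
    (A : Set (RSUQ.E n)) (hA : MeasurableSet A) (hAP : A ⊆ P) (hA0 : volume A ≠ 0)
    (f : RSUQ.E n → ℝ) (hf : Measurable f) (hf0 : ∀ x, 0 ≤ f x)
    (𝒳 : Set (RSUQ.E n)) (h𝒳 : MeasurableSet 𝒳) (hf𝒳 : ∀ x, x ∉ 𝒳 → f x = 0)
    (hh : RSUQ.DiffEntropyExists f)
    {Ω : Type*} [MeasurableSpace Ω] (μ : Measure Ω) [IsProbabilityMeasure μ]
    (X : Ω → RSUQ.E n) (S : Ω → (RSUQ.rsuq hP hA).State)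
    (hX : HasLaw X (volume.withDensity fun x => ENNReal.ofReal (f x)) μ)
    (hS : HasLaw S (RSUQ.rsuq hP hA).law μ)
    (hXS : IndepFun X S μ) :
    (RSUQ.rsuq hP hA).normalizedEntropy + RSUQ.diffEntropy f
        ≤ (RSUQ.condEntropy (fun ω => (RSUQ.rsuq hP hA).toFun (X ω) (S ω)) S μ : EReal) ∧
    (RSUQ.deltaBar f 𝒳 (Metric.diam A) ≠ ⊤ →
      (RSUQ.condEntropy (fun ω => (RSUQ.rsuq hP hA).toFun (X ω) (S ω)) S μ : EReal)
        ≤ (RSUQ.rsuq hP hA).normalizedEntropy + RSUQ.diffEntropy f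
          + (RSUQ.deltaBar f 𝒳 (Metric.diam A) : EReal)) ∧
    (RSUQ.deltaBar f 𝒳 (Metric.diam A) ≠ ⊤ →
      (RSUQ.condEntropy (fun ω => (RSUQ.rsuq hP hA).toFun (X ω) (S ω)) S μ : EReal)
        ≤ RSUQ.diffEntropy f - RSUQ.log2 (volume A)
          + (Real.logb 2 (Real.exp 1) : EReal)
          + (RSUQ.deltaBar f 𝒳 (Metric.diam A) : EReal)) := by
  set ℓ := ∫⁻ v, ENNReal.ofReal
    (Real.logb 2 ((volume A).toReal / (RSUQ.cellVolume hP A 0 v).toReal)) ∂(RSUQ.ditherLaw P)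
  have hQ : RSUQ.StationaryCells (RSUQ.rsuq hP hA) (Metric.diam A) (volume A) ℓ :=
    RSUQ.stationaryCells_rsuq hP hA hAP hA0
  have hℓ : ℓ ≤ ENNReal.ofReal (Real.logb 2 (Real.exp 1)) :=
    RSUQ.lintegral_logb_cellVolume_le hP hA hAP hA0
  have hℓt : ℓ ≠ ⊤ := ne_top_of_le_ne_top ENNReal.ofReal_ne_top hℓ
  have hH := hQ.normalizedEntropy_eq hℓt Metric.diam_nonneg
  have hupper := fun hδ => hQ.condEntropy_le hℓt hf hf0 h𝒳 hf𝒳 hh hX hS hXS hδ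
  rw [hH]
  refine ⟨hQ.le_condEntropy hℓt hf hf0 hh hX hS hXS, hupper, fun hδ => (hupper hδ).trans ?_⟩
  refine add_le_add_left ?_ _
  have hreal : ℓ.toReal - Real.logb 2 (volume A).toReal ≤
      -Real.logb 2 (volume A).toReal + Real.logb 2 (Real.exp 1) := by
    have := ENNReal.toReal_le_of_le_ofReal RSUQ.logb_two_exp_one_pos.le hℓ
    linarith
  rw [RSUQ.log2_eq_logb hA0 hQ.a_ne_top, sub_eq_add_neg (RSUQ.diffEntropy f), add_assoc, add_comm, ← EReal.coe_neg,
    ← EReal.coe_add]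
  exact add_le_add_right (EReal.coe_le_coe_iff.2 hreal) _
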